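/- **Conventions.** For a finite-dimensional nilpotent real Lie algebra $\mathfrak n$, identify $\Lambda^q\mathfrak n^*$ with the skew-symmetric $q$-forms on $\mathfrak n$, with the Chevalley–Eilenberg differential $d$, so that $(d\alpha)(x,y)=\alpha([x,y])$ for $\alpha\in\mathfrak n^*$ and $(d\omega)(x,y,z)=\omega([x,y],z)-\omega([x,z],y)+\omega([y,z],x)$ for $\omega\in\Lambda^2\mathfrak n^*$. Let $\mathfrak n^0=\mathfrak n$, $\mathfrak n^i=[\mathfrak n,\mathfrak n^{i-1}]$, and let $k$ be the least integer with $\mathfrak n^k=0$. Put $V_0=0$ and $V_i=\{\alpha\in\mathfrak n^*: d\alpha\in\Lambda^2V_{i-1}\}$ for $i\ge1$; then $V_k=\mathfrak n^*$. The subcomplexes $F^pC^*=\Lambda^*V_{k-p}$ ($p\ge 0$) filter the Chevalley–Eilenberg complex, and $E_\infty^{p,q}(\mathfrak n)$ is the limit term of the resulting spectral sequence, $$E_\infty^{p,q}(\mathfrak n)=\frac{\{x\in\Lambda^{p+q}V_{k-p}:dx=0\}}{d\big(\{x\in\Lambda^{p+q-1}\mathfrak n^*:dx\in\Lambda^{p+q}V_{k-p}\}\big)+\{x\in\Lambda^{p+q}V_{k-p-1}:dx=0\}}.$$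 Let $\mathfrak g_0$ be the split real form of a complex simple Lie algebra $\mathfrak g$, i.e. a real Lie algebra with $\mathfrak g_0\otimes_{\mathbb R}\mathbb C\cong\mathfrak g$ that has a splitting Cartan subalgebra. Let $\mathfrak h_0$ be any such Cartan subalgebra (for every $x\in\mathfrak h_0$, $\mathrm{ad}\,x$ is triangularizable over $\mathbb R$), choose any system of simple roots of $\mathfrak g_0$ with respect to $\mathfrak h_0$, let $\Delta^+$ be the corresponding set of positive roots, and let $$\mathfrak n=\bigoplus_{\alpha\in\Delta^+}(\mathfrak g_0)_\alpha ,$$ the nilradical of the minimal parabolic subalgebra $\mathfrak h_0\oplus\mathfrak n$ of $\mathfrak g_0$. **Lemma.** The Lie algebra $\mathfrak n$ is nilpotent, and $E_\infty^{0,2}(\mathfrak n)=0$ in each of the following cases: 1. $\mathfrak g=\mathfrak{sl}(n+1,\mathbb C)$ with $n\ge3$; 2. $\mathfrak g=\mathfrak{so}(2n+1,\mathbb C)$ with $n\ge3$; 3. $\mathfrak g=\mathfrak{sp}(2n,\mathbb C)$ with $n\ge3$; 4. $\mathfrak g=\mathfrak{so}(2n,\mathbb C)$ with $n\ge4$. 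-/

import Mathlib

open scoped TensorProduct

noncomputable section

/-! ### Forms of low degree on a real Lie algebra and the differential

Skew-symmetric `q`-forms are identified with skew-symmetric multilinear maps; one-forms are elements
of `Module.Dual ℝ L`, two-forms are bilinear maps `L →ₗ[ℝ] L →ₗ[ℝ] ℝ`. -/

namespace LieForms

variable (L : Type*) [LieRing L] [LieAlgebra ℝ L]

/-- The space of bilinear forms on `L`; the two-forms are the skew-symmetric ones. -/
abbrev Bilin := L →ₗ[ℝ] L →ₗ[ℝ] ℝ

variable {L}

/-- The wedge product of two one-forms: `(α ∧ β)(x, y) = α x * β y - α y * β x`. -/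
def wedge (α β : Module.Dual ℝ L) : Bilin L :=
  LinearMap.mk₂ ℝ (fun x y => α x * β y - α y * β x)
    (fun x x' y => by simp only [map_add]; ring)
    (fun c x y => by simp only [map_smul, smul_eq_mul]; ring)
    (fun x y y' => by simp only [map_add]; ring)
    (fun c x y => by simp only [map_smul, smul_eq_mul]; ring)

/-- `Λ² V` for a space `V` of one-forms: the span of the `α ∧ β` with `α, β ∈ V`. -/
def wedgeSq (V : Submodule ℝ (Module.Dual ℝ L)) : Submodule ℝ (Bilin L) :=
  Submodule.span ℝ {ω | ∃ α ∈ V, ∃ β ∈ V, ω = wedge α β}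

variable (L)

/-- The differential of one-forms: `(d α)(x, y) = α ⁅x, y⁆`. -/
def d₁ : Module.Dual ℝ L →ₗ[ℝ] Bilin L where
  toFun α := LinearMap.mk₂ ℝ (fun x y => α ⁅x, y⁆)
    (fun x x' y => by simp only [add_lie, map_add])
    (fun c x y => by simp only [smul_lie, map_smul])
    (fun x y y' => by simp only [lie_add, map_add])
    (fun c x y => by simp only [lie_smul, map_smul])
  map_add' α β := by ext x y; simp
  map_smul' c α := by ext x y; simp

/-- The two-forms that are closed, i.e. satisfy `d ω = 0`, where
`(d ω)(x, y, z) = ω(⁅x, y⁆, z) - ω(⁅x, z⁆, y) + ω(⁅y, z⁆, x)`. -/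
def closedTwoForms : Submodule ℝ (Bilin L) where
  carrier := {ω | (∀ x, ω x x = 0) ∧
    ∀ x y z, ω ⁅x, y⁆ z - ω ⁅x, z⁆ y + ω ⁅y, z⁆ x = 0}
  zero_mem' := by simp
  add_mem' := by
    rintro ω η ⟨h₁, h₂⟩ ⟨k₁, k₂⟩
    refine ⟨fun x => by simp [h₁, k₁], fun x y z => ?_⟩
    have := h₂ x y z
    have := k₂ x y z
    simp only [LinearMap.add_apply]
    linarith
  smul_mem' := by
    rintro c ω ⟨h₁, h₂⟩
    refine ⟨fun x => by simp [h₁], fun x y z => ?_⟩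
    have := h₂ x y z
    simp only [LinearMap.smul_apply, smul_eq_mul]
    linear_combination c * this

/-- The canonical filtration of the dual: `V 0 = 0` and `V (i + 1) = {α | d α ∈ Λ² (V i)}`. -/
def V : ℕ → Submodule ℝ (Module.Dual ℝ L)
  | 0 => ⊥
  | i + 1 => (wedgeSq (V i)).comap (d₁ L)

/-- The nilpotency index: the least `k` for which the `k`-th term of the central descending series
(starting with `L` itself as term number `0`) vanishes. It is used for nilpotent `L` only. -/
def nilIndex : ℕ := LieModule.nilpotencyLength L L

/-- The part of degree two of the `p`-th piece of the filtration of the Chevalley-Eilenberg complex: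
`F^p C² = Λ² (V (k - p))`, where `k` is the nilpotency index (it is `0` for `p ≥ k`). -/
def F (p : ℕ) : Submodule ℝ (Bilin L) := wedgeSq (V L (nilIndex L - p))

/-- The permanent cycles `Z_∞^{p,2-p} = {x ∈ F^p C² | d x = 0}`. -/
def ZInf (p : ℕ) : Submodule ℝ (Bilin L) := F L p ⊓ closedTwoForms L

/-- The boundaries `B_∞^{p,2-p} = d C¹ ∩ F^p C² = d {x ∈ C¹ | d x ∈ F^p C²}`. -/
def BInf (p : ℕ) : Submodule ℝ (Bilin L) := ((F L p).comap (d₁ L)).map (d₁ L)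

/-- The subquotient `Z / (Z ∩ D)` of a vector space; this is `Z / D` when `D ≤ Z`. -/
def Subquotient {M : Type*} [AddCommGroup M] [Module ℝ M] (Z D : Submodule ℝ M) : Type _ :=
  Z ⧸ D.submoduleOf Z

instance {M : Type*} [AddCommGroup M] [Module ℝ M] (Z D : Submodule ℝ M) :
    AddCommGroup (Subquotient Z D) :=
  inferInstanceAs (AddCommGroup (Z ⧸ D.submoduleOf Z))

instance {M : Type*} [AddCommGroup M] [Module ℝ M] (Z D : Submodule ℝ M) :
    Module ℝ (Subquotient Z D) :=
  inferInstanceAs (Module ℝ (Z ⧸ D.submoduleOf Z))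

theorem subsingleton_subquotient_iff {M : Type*} [AddCommGroup M] [Module ℝ M]
    (Z D : Submodule ℝ M) : Subsingleton (Subquotient Z D) ↔ Z ≤ D := by
  unfold Subquotient
  rw [Submodule.Quotient.subsingleton_iff, Submodule.submoduleOf_eq_top]

/-- The limit term `E_∞^{p,2-p} = Z_∞^{p,2-p} / (B_∞^{p,2-p} + Z_∞^{p+1,1-p})` of the spectral
sequence of the filtered Chevalley-Eilenberg complex of `L`, in total degree two. -/
abbrev EInf (p : ℕ) : Type _ :=
  Subquotient (M := Bilin L) (ZInf L p) (BInf L p ⊔ ZInf L (p + 1))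

end LieForms

/-! ### Roots, simple systems and the nilradical of a minimal parabolic subalgebra -/

namespace SplitLie

variable {𝔤 : Type*} [LieRing 𝔤] [LieAlgebra ℝ 𝔤]

/-- The roots of `𝔤` with respect to `H`: nonzero functionals with nonzero root space. -/
def roots (H : LieSubalgebra ℝ 𝔤) [LieRing.IsNilpotent H] : Set (Module.Dual ℝ H) :=
  {α | α ≠ 0 ∧ LieAlgebra.rootSpace H α ≠ ⊥}

/-- A system of simple roots: linearly independent roots such that each root is a combination of
them with natural number coefficients, or the negative of such a combination. -/
structure SimpleSystem (H : LieSubalgebra ℝ 𝔤) [LieRing.IsNilpotent H] where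
  simple : Set (Module.Dual ℝ H)
  subset_roots : simple ⊆ roots H
  linearIndep : LinearIndepOn ℝ id simple
  pos_or_neg : ∀ α ∈ roots H,
    α ∈ AddSubmonoid.closure simple ∨ -α ∈ AddSubmonoid.closure simple

namespace SimpleSystem

variable {H : LieSubalgebra ℝ 𝔤} [LieRing.IsNilpotent H]

/-- The positive roots: the roots that are combinations of simple roots with natural number
coefficients. -/
def positiveRoots (S : SimpleSystem H) : Set (Module.Dual ℝ H) :=
  {α | α ∈ roots H ∧ α ∈ AddSubmonoid.closure S.simple}

theorem add_ne_zero (S : SimpleSystem H) {α β : Module.Dual ℝ H}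
    (hα : α ∈ S.positiveRoots) (hβ : β ∈ S.positiveRoots) : α + β ≠ 0 := by
  have hli : LinearIndepOn ℝ id S.simple := S.linearIndep
  let b := Module.Basis.extend hli
  let f : Module.Dual ℝ H →ₗ[ℝ] ℝ := b.constr ℝ (fun _ => (1 : ℝ))
  have hf : ∀ δ ∈ S.simple, f δ = 1 := by
    intro δ hδ
    have h := b.constr_basis ℝ (fun _ => (1 : ℝ))
      ⟨δ, hli.subset_extend (Set.subset_univ _) hδ⟩
    rwa [Module.Basis.extend_apply_self] at h
  have key : ∀ γ ∈ AddSubmonoid.closure S.simple, γ = 0 ∨ 0 < f γ := by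
    intro γ hγ
    induction hγ using AddSubmonoid.closure_induction with
    | mem x hx => right; rw [hf x hx]; exact one_pos
    | zero => left; rfl
    | add x y _ _ hx hy =>
      rcases hx with rfl | hx
      · simpa using hy
      · rcases hy with rfl | hy
        · right; simpa using hx
        · right; rw [map_add]; exact add_pos hx hy
  intro h
  have h1 := (key α hα.2).resolve_left hα.1.1
  have h2 := (key β hβ.2).resolve_left hβ.1.1
  have h3 : f α + f β = 0 := by rw [← map_add, h, map_zero]
  linarith

/-- The nilradical `𝔫 = ⨁_{α > 0} 𝔤_α` of the minimal parabolic subalgebra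
`H ⊕ ⨁_{α > 0} 𝔤_α` given by `H` and a system of simple roots. -/
def nilradical (S : SimpleSystem H) : LieSubalgebra ℝ 𝔤 where
  toSubmodule := ⨆ α ∈ S.positiveRoots, (LieAlgebra.rootSpace H α).toSubmodule
  lie_mem' := by
    intro x y hx hy
    change ⁅x, y⁆ ∈ ⨆ α ∈ S.positiveRoots, (LieAlgebra.rootSpace H α).toSubmodule
    change x ∈ ⨆ α ∈ S.positiveRoots, (LieAlgebra.rootSpace H α).toSubmodule at hx
    change y ∈ ⨆ α ∈ S.positiveRoots, (LieAlgebra.rootSpace H α).toSubmodule at hy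
    have main : ∀ α ∈ S.positiveRoots, ∀ β ∈ S.positiveRoots,
        ∀ u ∈ LieAlgebra.rootSpace H α, ∀ v ∈ LieAlgebra.rootSpace H β,
        ⁅u, v⁆ ∈ ⨆ α ∈ S.positiveRoots, (LieAlgebra.rootSpace H α).toSubmodule := by
      intro α hα β hβ u hu v hv
      have huv : ⁅u, v⁆ ∈ LieAlgebra.rootSpace H (α + β : Module.Dual ℝ H) :=
        LieAlgebra.lie_mem_genWeightSpace_of_mem_genWeightSpace hu hv
      by_cases hr : LieAlgebra.rootSpace H (α + β : Module.Dual ℝ H) = ⊥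
      · rw [hr, LieSubmodule.mem_bot] at huv
        rw [huv]
        exact Submodule.zero_mem _
      · exact Submodule.mem_iSup_of_mem (α + β) (Submodule.mem_iSup_of_mem
          ⟨⟨S.add_ne_zero hα hβ, hr⟩, add_mem hα.2 hβ.2⟩ huv)
    induction hx using Submodule.iSup_induction' with
    | zero => rw [zero_lie]; exact Submodule.zero_mem _
    | add a b _ _ ha hb => rw [add_lie]; exact Submodule.add_mem _ ha hb
    | mem α u hu =>
      by_cases hα : α ∈ S.positiveRoots
      · simp only [hα, iSup_pos] at hu
        induction hy using Submodule.iSup_induction' with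
        | zero => rw [lie_zero]; exact Submodule.zero_mem _
        | add a b _ _ ha hb => rw [lie_add]; exact Submodule.add_mem _ ha hb
        | mem β v hv =>
          by_cases hβ : β ∈ S.positiveRoots
          · simp only [hβ, iSup_pos] at hv
            exact main α hα β hβ u hu v hv
          · simp only [hβ, not_false_eq_true, iSup_neg, Submodule.mem_bot] at hv
            rw [hv, lie_zero]; exact Submodule.zero_mem _
      · simp only [hα, not_false_eq_true, iSup_neg, Submodule.mem_bot] at hu
        rw [hu, zero_lie]; exact Submodule.zero_mem _

end SimpleSystem

/-- `𝔤` is a real form of the complex Lie algebra `𝔩`. -/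
def IsRealForm (𝔤 : Type*) [LieRing 𝔤] [LieAlgebra ℝ 𝔤]
    (𝔩 : Type*) [LieRing 𝔩] [LieAlgebra ℂ 𝔩] : Prop :=
  Nonempty ((ℂ ⊗[ℝ] 𝔤) ≃ₗ⁅ℂ⁆ 𝔩)

end SplitLie

end

/-! ### Simplicity of the special linear Lie algebras -/

namespace ClassicalSimple

open Matrix LieAlgebra

attribute [local instance] LieRing.ofAssociativeRing

variable {K : Type*} [Field K] {n : Type*} [Fintype n] [DecidableEq n]

/-! Write `k` for the nilpotency index of the nilradical `𝔫`. The claim follows once every closed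
two-form `ω` on `𝔫` lies in `Λ² V_{k-1}`; boundaries are not needed. The annihilator of the term
`𝔫^{k-1}` is contained in `V_{k-1}`, so it is enough that `ω(z, x) = 0` for `z ∈ 𝔫^{k-1}` and all
`x` (`subsingleton_EInf_zero`). Such `z` are central, and the center is a sum of weight spaces, so
`z` may be taken to be a root vector whose root `θ` is maximal.

If `x = [u, v]` with `u`, `v` in `𝔫`, closedness on `(u, v, z)` gives `ω(x, z) = 0`, because `z` is
central. This covers root vectors of nonsimple positive roots. The remaining case is a root vector
`e` of a simple root `a` (`apply_eq_zero_of_mem_support`). Let `P` be the sum of the positive root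
spaces other than that of `a`; it is a module over the `sl₂` of `a`, and the bracket on `P ⊗ P` is
`sl₂`-equivariant. In rank at least three, `θ` is a sum of two positive roots different from `a`
(`exists_add_of_maximal`), so `z` is the bracket of some element of `P ⊗ P`. Since `e` kills `z`,
that element can be corrected to a `u` with `e · u = 0` (`exists_lie_e_eq_zero`). Closedness,
extended linearly to `P ⊗ P`, reads `ω([u], e) = -ω(e · u)`, and the right-hand side vanishes. In
type `A₂` no such decomposition of `θ` exists.

The four families enter only through simplicity and dimension at least 15. Both pass from the
complex algebra to its real form, and an irreducible root system of rank at most two has at most 12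
roots, hence dimension at most 14; so the rank is at least three. -/

theorem isSimple_of_forall_submodule (A : LieSubalgebra K (Matrix n n K))
    (hA : ∃ X ∈ A, ∃ Y ∈ A, X * Y ≠ Y * X)
    (h : ∀ J : Submodule K (Matrix n n K), J ≤ A.toSubmodule →
      (∀ X ∈ A, ∀ Y ∈ J, X * Y - Y * X ∈ J) → (∃ X ∈ J, X ≠ 0) → A.toSubmodule ≤ J) :
    IsSimple K A where
  eq_bot_or_eq_top I := by
    by_cases hI : I = ⊥
    · exact Or.inl hI
    right
    have := h (I.toSubmodule.map A.toSubmodule.subtype) ?_ ?_ ?_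
    · rw [eq_top_iff]
      rintro ⟨x, hx⟩ -
      obtain ⟨y, hy, rfl⟩ := this hx
      exact hy
    · rintro _ ⟨y, -, rfl⟩
      exact y.2
    · rintro X hX _ ⟨y, hy, rfl⟩
      exact ⟨⁅(⟨X, hX⟩ : A), y⁆, I.lie_mem hy, rfl⟩
    · by_contra! hc
      exact hI ((LieSubmodule.eq_bot_iff I).2 fun x hx => Subtype.ext (hc x ⟨x, hx, rfl⟩))
  non_abelian hab := by
    obtain ⟨X, hX, Y, hY, hne⟩ := hA
    have := congrArg Subtype.val (hab.trivial (⟨X, hX⟩ : A) (⟨Y, hY⟩ : A))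
    exact hne (sub_eq_zero.1 this)

section SpecialLinear

variable (J : Submodule K (Matrix n n K))

theorem mem_sl {X : Matrix n n K} : X ∈ SpecialLinear.sl n K ↔ X.trace = 0 := Iff.rfl

theorem single_mem_sl {i j : n} (h : i ≠ j) : Matrix.single i j (1 : K) ∈ SpecialLinear.sl n K :=
  mem_sl.2 (Matrix.trace_single_eq_of_ne i j 1 h)

/-- A matrix of trace zero is a combination of the matrix units off the diagonal and of differences
of matrix units on the diagonal. -/
theorem sl_le_of_single_mem
    (h₁ : ∀ i j, i ≠ j → Matrix.single i j (1 : K) ∈ J)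
    (h₂ : ∀ i j, i ≠ j → Matrix.single i i (1 : K) - Matrix.single j j (1 : K) ∈ J) :
    (SpecialLinear.sl n K).toSubmodule ≤ J := by
  intro X hX
  have hX : X.trace = 0 := hX
  rcases isEmpty_or_nonempty n with hn | ⟨⟨o⟩⟩
  · rw [Subsingleton.elim X 0]; exact zero_mem _
  have key : X = ∑ i, ∑ j, if i = j then X i i • (single i i (1 : K) - single o o 1)
      else X i j • single i j 1 := by
    have h₃ : ∀ i, (∑ j, if i = j then X i i • (single i i (1 : K) - single o o 1)
      else X i j • single i j 1) = (∑ j, X i j • single i j 1) - X i i • single o o 1 := by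
      intro i
      rw [Finset.sum_congr rfl (g := fun j => X i j • single i j (1 : K) -
        if i = j then X i i • single o o (1 : K) else 0)]
      · rw [Finset.sum_sub_distrib, Finset.sum_ite_eq, if_pos (Finset.mem_univ i)]
      · intro j _
        split_ifs with hij
        · rw [← hij, smul_sub]
        · rw [sub_zero]
    simp_rw [h₃, Finset.sum_sub_distrib, ← Finset.sum_smul]
    have h₄ : ∑ i, X i i = 0 := hX
    rw [h₄, zero_smul, sub_zero]
    conv_lhs => rw [Matrix.matrix_eq_sum_single X]
    simp [Matrix.smul_single]
  rw [key]
  refine Submodule.sum_mem _ fun i _ => Submodule.sum_mem _ fun j _ => ?_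
  split_ifs with hij
  · by_cases hio : i = o
    · simp [hio]
    · exact J.smul_mem _ (h₂ i o hio)
  · exact J.smul_mem _ (h₁ i j hij)

/-- Brackets with matrix units change one index at a time. A third index `m` is needed to move the
row index back to `j`. -/
theorem sl_le_of_single_mem_of_lie_mem (hn : 3 ≤ Fintype.card n)
    (hJ : ∀ X ∈ SpecialLinear.sl n K, ∀ Y ∈ J, X * Y - Y * X ∈ J)
    {i j : n} (hij : i ≠ j) (h : single i j (1 : K) ∈ J) :
    (SpecialLinear.sl n K).toSubmodule ≤ J := by
  have left : ∀ k, k ≠ j → single k j (1 : K) ∈ J := by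
    intro k hk
    by_cases hki : k = i
    · rwa [hki]
    · simpa [hk.symm, hki] using hJ _ (single_mem_sl hki) _ h
  have right : ∀ k l, k ≠ j → k ≠ l → single k l (1 : K) ∈ J := by
    intro k l hk hkl
    by_cases hl : j = l
    · rw [← hl]; exact left k hk
    · have := J.neg_mem (hJ _ (single_mem_sl hl) _ (left k hk))
      simpa [hk.symm, hkl.symm] using this
  have all : ∀ k l, k ≠ l → single k l (1 : K) ∈ J := by
    intro k l hkl
    by_cases hk : k = j
    · obtain ⟨m, hm⟩ : ∃ m, m ∉ ({j, l} : Finset n) := by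
        by_contra! hc
        have := Finset.card_le_card (fun x _ => hc x : (Finset.univ : Finset n) ⊆ {j, l})
        have := Finset.card_le_two (a := j) (b := l)
        rw [Finset.card_univ] at *
        omega
      simp only [Finset.mem_insert, Finset.mem_singleton, not_or] at hm
      subst hk
      have := hJ _ (single_mem_sl (Ne.symm hm.1)) _ (right m l hm.1 hm.2)
      simpa [hkl.symm, hkl] using this
    · exact right k l hk hkl
  refine sl_le_of_single_mem J all fun k l hkl => ?_
  simpa using hJ _ (single_mem_sl hkl) _ (all l k hkl.symm)

/-- If `X` has a nonzero entry at `(i, j)` off the diagonal, applying `ad E_ji` twice isolates a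
nonzero multiple of `E_ji`. A nonzero diagonal `X` of trace zero is not scalar in characteristic
zero, and then one bracket with a suitable `E_ij` suffices. -/
theorem isSimple_sl [CharZero K] (hn : 3 ≤ Fintype.card n) :
    IsSimple K (SpecialLinear.sl n K) := by
  obtain ⟨a, b, hab⟩ := Fintype.exists_pair_of_one_lt_card (α := n) (by omega)
  refine isSimple_of_forall_submodule _ ⟨_, single_mem_sl hab, _, single_mem_sl hab.symm, ?_⟩ ?_
  · intro h
    have := congrFun (congrFun h a) a
    simp [hab] at this
  rintro J hJA hJ ⟨X, hX, hX0⟩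
  by_cases hd : ∃ i j, i ≠ j ∧ X i j ≠ 0
  · obtain ⟨i, j, hij, hne⟩ := hd
    refine sl_le_of_single_mem_of_lie_mem J hn hJ hij.symm ?_
    have h1 := hJ _ (single_mem_sl hij.symm) _ (hJ _ (single_mem_sl hij.symm) _ hX)
    have h2 : single j i (1 : K) * (single j i 1 * X - X * single j i 1) -
        (single j i 1 * X - X * single j i 1) * single j i 1 = (-2 * X i j) • single j i 1 := by
      simp only [mul_sub, sub_mul, ← mul_assoc, single_mul_mul_single]
      simp only [mul_assoc, single_mul_single_of_ne _ _ _ _ hij, Matrix.mul_zero]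
      simp only [← mul_assoc, Matrix.zero_mul, smul_single]
      ext k l
      simp only [Matrix.sub_apply, Matrix.zero_apply, single_apply]
      split_ifs <;> simp <;> ring
    rw [h2] at h1
    exact (J.smul_mem_iff (mul_ne_zero (by norm_num) hne)).1 h1
  · push Not at hd
    obtain ⟨i, j, hij⟩ : ∃ i j, X i i ≠ X j j := by
      by_contra! hc
      have ht : X.trace = 0 := hJA hX
      have h0 : ∀ i, X i i = 0 := by
        intro i
        have : X.trace = (Fintype.card n : K) * X i i := by
          rw [Matrix.trace, Finset.sum_congr rfl (fun k _ => show X.diag k = X i i from hc k i)]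
          simp
        rw [ht] at this
        exact (mul_eq_zero.1 this.symm).resolve_left (Nat.cast_ne_zero.2 (by omega))
      refine hX0 ?_
      ext i j
      by_cases hij : i = j
      · rw [hij, h0, Matrix.zero_apply]
      · exact hd i j hij
    have hne : i ≠ j := fun h => hij (by rw [h])
    refine sl_le_of_single_mem_of_lie_mem J hn hJ hne ?_
    have h1 := hJ _ (single_mem_sl hne) _ hX
    have h2 : single i j (1 : K) * X - X * single i j 1 = (X j j - X i i) • single i j 1 := by
      have hX' : X = diagonal (fun k => X k k) := by
        ext k l
        by_cases hkl : k = l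
        · simp [hkl]
        · rw [diagonal_apply_ne _ hkl, hd k l hkl]
      ext k l
      rw [hX']
      simp only [Matrix.sub_apply, mul_diagonal, diagonal_mul, Matrix.smul_apply, single_apply, smul_eq_mul,
        diagonal_apply_eq]
      split_ifs with h
      · rw [h.1, h.2]; ring
      · ring
    rw [h2] at h1
    exact (J.smul_mem_iff (sub_ne_zero.2 hij.symm)).1 h1

end SpecialLinear

end ClassicalSimple

/-! ### Simplicity of the orthogonal Lie algebras -/

namespace ClassicalSimple

open Matrix LieAlgebra

attribute [local instance] LieRing.ofAssociativeRing

variable {K : Type*} [Field K] {n : Type*} [Fintype n] [DecidableEq n]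

section Orthogonal

/-- The skew-symmetric matrix `v wᵀ - w vᵀ`. -/
def skewMat (v w : n → K) : Matrix n n K := vecMulVec v w - vecMulVec w v

theorem skewMat_mem (v w : n → K) : skewMat v w ∈ Orthogonal.so n K := by
  rw [Orthogonal.mem_so, skewMat, transpose_sub, transpose_vecMulVec, transpose_vecMulVec, neg_sub]

theorem skewMat_lie (v w x y : n → K) :
    skewMat v w * skewMat x y - skewMat x y * skewMat v w =
      (w ⬝ᵥ x) • skewMat v y - (w ⬝ᵥ y) • skewMat v x - (v ⬝ᵥ x) • skewMat w y
        + (v ⬝ᵥ y) • skewMat w x := by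
  simp only [skewMat, mul_sub, sub_mul, vecMulVec_mul_vecMulVec, vecMulVec_smul, smul_sub]
  rw [dotProduct_comm x v, dotProduct_comm x w, dotProduct_comm y v, dotProduct_comm y w]
  module

/-- For `v`, `w` spanning a totally isotropic space, `A = skewMat v w` satisfies `A² = 0`, and
skewness of `X` makes `A X A` a multiple of `A`. So `(ad A)²` maps the whole algebra into the line
of `A`. -/
theorem lie_lie_skewMat {v w : n → K} (hv : v ⬝ᵥ v = 0) (hw : w ⬝ᵥ w = 0) (hvw : v ⬝ᵥ w = 0)
    {X : Matrix n n K} (hX : Xᵀ = -X) (h2 : (2 : K) ≠ 0) :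
    skewMat v w * (skewMat v w * X - X * skewMat v w) -
      (skewMat v w * X - X * skewMat v w) * skewMat v w = (-2 * (w ⬝ᵥ X *ᵥ v)) • skewMat v w := by
  have hwv : w ⬝ᵥ v = 0 := by rw [dotProduct_comm, hvw]
  have hq : ∀ x y : n → K, x ⬝ᵥ X *ᵥ y = -(y ⬝ᵥ X *ᵥ x) := by
    intro x y
    rw [dotProduct_mulVec, ← mulVec_transpose, hX, neg_mulVec, neg_dotProduct, dotProduct_comm]
  have hs : ∀ x : n → K, x ⬝ᵥ X *ᵥ x = 0 := by
    intro x
    have := hq x x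
    have h3 : 2 * (x ⬝ᵥ X *ᵥ x) = 0 := by linear_combination this
    exact (mul_eq_zero.1 h3).resolve_left h2
  have e1 : skewMat v w * skewMat v w = 0 := by
    simp [skewMat, mul_sub, sub_mul, vecMulVec_mul_vecMulVec, hv, hw, hvw, hwv]
  have e2 : skewMat v w * X * skewMat v w = (w ⬝ᵥ X *ᵥ v) • skewMat v w := by
    simp only [skewMat, mul_sub, sub_mul, mul_assoc, mul_vecMulVec, hs,
      hq v w, vecMulVec_mulVec]
    simp only [op_smul_eq_smul, smul_vecMulVec, zero_smul, smul_sub, neg_smul,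
      zero_vecMulVec, neg_vecMulVec]
    abel
  have : skewMat v w * (skewMat v w * X - X * skewMat v w) -
      (skewMat v w * X - X * skewMat v w) * skewMat v w =
      skewMat v w * skewMat v w * X - (2 : K) • (skewMat v w * X * skewMat v w)
        + X * (skewMat v w * skewMat v w) := by
    rw [two_smul]; noncomm_ring
  rw [this, e1, e2]
  simp [smul_smul]

theorem so_le_of_skewMat_single_mem (J : Submodule K (Matrix n n K)) (h2 : (2 : K) ≠ 0)
    (h : ∀ i j, i ≠ j → skewMat (Pi.single i (1 : K)) (Pi.single j 1) ∈ J) :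
    (Orthogonal.so n K).toSubmodule ≤ J := by
  intro X hX
  have hX : Xᵀ = -X := (Orthogonal.mem_so n K X).1 hX
  have key : (2 : K) • X =
      ∑ i, ∑ j, X i j • skewMat (Pi.single i (1 : K)) (Pi.single j 1) := by
    have e : ∀ i j, X i j • skewMat (Pi.single i (1 : K)) (Pi.single j 1) =
        single i j (X i j) - single j i (X i j) := by
      intro i j
      rw [skewMat, ← single_eq_single_vecMulVec_single, ← single_eq_single_vecMulVec_single,
        smul_sub, smul_single, smul_single, smul_eq_mul, mul_one]
    simp_rw [e, Finset.sum_sub_distrib]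
    rw [Finset.sum_comm (f := fun i j => single j i (X i j)), ← Matrix.matrix_eq_sum_single X]
    have : ∑ j, ∑ i, single j i (X i j) = Xᵀ := by
      conv_rhs => rw [Matrix.matrix_eq_sum_single Xᵀ]
      rfl
    rw [this, hX, two_smul, sub_neg_eq_add]
  rw [← J.smul_mem_iff h2, key]
  refine Submodule.sum_mem _ fun i _ => Submodule.sum_mem _ fun j _ => J.smul_mem _ ?_
  by_cases hij : i = j
  · rw [hij, skewMat, sub_self]; exact zero_mem _
  · exact h i j hij

end Orthogonal

theorem exists_notMem_of_card_lt (s : Finset n) (h : s.card < Fintype.card n) : ∃ i, i ∉ s := by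
  by_contra! hc
  have := Finset.card_le_card (fun x _ => hc x : (Finset.univ : Finset n) ⊆ s)
  rw [Finset.card_univ] at this
  omega

/-- A nonzero ideal is first shown to contain some `skewMat v w` with isotropic `v`, `w` supported
on two disjoint pairs of indices. Brackets with coordinate matrices at two further indices then
produce a coordinate matrix, which generates everything; this uses six indices. -/
theorem isSimple_so {n : Type*} [Fintype n] [DecidableEq n] (hn : 6 ≤ Fintype.card n) :
    IsSimple ℂ (Orthogonal.so n ℂ) := by
  have fresh : ∀ s : Finset n, s.card ≤ 5 → ∃ i, i ∉ s := fun s hs =>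
    exists_notMem_of_card_lt s (by omega)
  have gen : ∀ J : Submodule ℂ (Matrix n n ℂ),
      (∀ X ∈ Orthogonal.so n ℂ, ∀ Y ∈ J, X * Y - Y * X ∈ J) →
      ∀ k l, k ≠ l → skewMat (Pi.single k (1 : ℂ)) (Pi.single l 1) ∈ J →
      (Orthogonal.so n ℂ).toSubmodule ≤ J := by
    intro J hJ k l hkl h
    have swap : ∀ i j, skewMat (Pi.single i (1 : ℂ)) (Pi.single j 1) ∈ J →
        skewMat (Pi.single j (1 : ℂ)) (Pi.single i 1) ∈ J := by
      intro i j hij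
      have := J.neg_mem hij
      rwa [skewMat, neg_sub] at this
    have step : ∀ i j m, i ≠ j → m ≠ i → m ≠ j →
        skewMat (Pi.single i (1 : ℂ)) (Pi.single j 1) ∈ J →
        skewMat (Pi.single m (1 : ℂ)) (Pi.single j 1) ∈ J := by
      intro i j m hij hmi hmj h
      have := hJ _ (skewMat_mem (Pi.single m 1) (Pi.single i 1)) _ h
      rw [skewMat_lie] at this
      simpa [hij, hij.symm, hmi, hmi.symm, hmj, hmj.symm] using this
    have step' : ∀ m, m ≠ l → skewMat (Pi.single m (1 : ℂ)) (Pi.single l 1) ∈ J := by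
      intro m hm
      by_cases hmk : m = k
      · rwa [hmk]
      · exact step k l m hkl hmk hm h
    refine so_le_of_skewMat_single_mem J two_ne_zero fun i j hij => ?_
    by_cases hj : j = l
    · rw [hj] at hij ⊢
      exact step' i hij
    by_cases hi : i = l
    · rw [hi]
      exact swap _ _ (step' j hj)
    · exact swap _ _ (step l i j (Ne.symm hi) hj hij.symm (swap _ _ (step' i hi)))
  obtain ⟨a, ha⟩ := fresh ∅ (by simp)
  obtain ⟨b, hb⟩ := fresh {a} (by simp)
  obtain ⟨c, hc⟩ := fresh {a, b} (Finset.card_le_two.trans (by norm_num))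
  simp only [Finset.mem_insert, Finset.mem_singleton, not_or] at hb hc
  refine isSimple_of_forall_submodule _ ⟨_, skewMat_mem (Pi.single a 1) (Pi.single b 1), _,
    skewMat_mem (Pi.single b 1) (Pi.single c 1), ?_⟩ ?_
  · intro h
    have h' := skewMat_lie (Pi.single a (1 : ℂ)) (Pi.single b 1) (Pi.single b 1) (Pi.single c 1)
    rw [h, sub_self] at h'
    have := congrFun (congrFun h' a) c
    simp [hb, hc, Ne.symm hc.1, skewMat, vecMulVec_apply] at this
  clear! a b c
  rintro J hJA hJ ⟨X, hX, hX0⟩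
  have hXt : Xᵀ = -X := (Orthogonal.mem_so n ℂ X).1 (hJA hX)
  have hXd : ∀ i, X i i = 0 := by
    intro i
    have : X i i = -X i i := congrFun (congrFun hXt i) i
    exact self_eq_neg.1 this
  obtain ⟨c, a, hne⟩ : ∃ c a, X c a ≠ 0 := by
    by_contra! h
    exact hX0 (Matrix.ext h)
  have hca : c ≠ a := by
    rintro rfl
    exact hne (hXd c)
  obtain ⟨b, hb⟩ := fresh {a, c} (Finset.card_le_two.trans (by norm_num))
  obtain ⟨d, hd⟩ := fresh {a, c, b} (Finset.card_le_three.trans (by norm_num))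
  obtain ⟨k, hk⟩ := fresh {a, c, b, d} (Finset.card_le_four.trans (by norm_num))
  obtain ⟨l, hl⟩ := fresh {a, c, b, d, k} Finset.card_le_five
  simp only [Finset.mem_insert, Finset.mem_singleton, not_or] at hb hd hk hl
  -- The displayed sum is `w ⬝ᵥ X *ᵥ v` for the isotropic vectors chosen below. Summed over the four
  -- sign choices `s, t = ±i` it gives `4 * X c a`, so it is nonzero for one of them.
  obtain ⟨s, t, hs, ht, hst⟩ : ∃ s t : ℂ, s * s = -1 ∧ t * t = -1 ∧
      X c a + s * X c b + t * X d a + s * t * X d b ≠ 0 := by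
    by_contra! h
    have h1 := h Complex.I Complex.I (by simp) (by simp)
    have h2 := h Complex.I (-Complex.I) (by simp) (by simp)
    have h3 := h (-Complex.I) Complex.I (by simp) (by simp)
    have h4 := h (-Complex.I) (-Complex.I) (by simp) (by simp)
    have : 4 * X c a = 0 := by linear_combination h1 + h2 + h3 + h4
    exact hne ((mul_eq_zero.1 this).resolve_left (by norm_num))
  set v : n → ℂ := Pi.single a 1 + Pi.single b s with hv
  set w : n → ℂ := Pi.single c 1 + Pi.single d t with hw
  have hvw : skewMat v w ∈ J := by
    have h1 := hJ _ (skewMat_mem v w) _ (hJ _ (skewMat_mem v w) _ hX)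
    rw [lie_lie_skewMat _ _ _ hXt two_ne_zero] at h1
    · refine (J.smul_mem_iff (mul_ne_zero (by norm_num) ?_)).1 h1
      convert hst using 1
      simp [hv, hw, mulVec_add, add_dotProduct]
      ring
    · simp [hv, hb, Ne.symm hb.1, hs]
    · simp [hw, hd, Ne.symm hd.2.1, ht]
    · simp [hv, hw, hd, hca, Ne.symm hb.2]
  have hkv : skewMat (Pi.single k 1) v ∈ J := by
    have := hJ _ (skewMat_mem (Pi.single k 1) (Pi.single c 1)) _ hvw
    rw [skewMat_lie] at this
    have := J.neg_mem this
    simpa [hv, hw, hb, hd, hk, hca, Ne.symm hca, Ne.symm hb.2, Ne.symm hd.2.1,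
      Ne.symm hk.1, Ne.symm hk.2.1, Ne.symm hk.2.2.1, Ne.symm hk.2.2.2] using this
  refine gen J hJ l k hl.2.2.2.2 ?_
  have := hJ _ (skewMat_mem (Pi.single l 1) (Pi.single a 1)) _ hkv
  rw [skewMat_lie] at this
  have := J.neg_mem this
  simpa [hv, hb, hk, hl, Ne.symm hb.1, Ne.symm hk.1, Ne.symm hl.1, Ne.symm hl.2.2.1,
    Ne.symm hk.2.2.1, Ne.symm hl.2.2.2.2] using this

/-! ### Simplicity of the symplectic Lie algebras -/

section Symplectic

variable {l : Type*} [Fintype l] [DecidableEq l]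

/-- The matrix `v (J v)ᵀ`, an element of the symplectic Lie algebra. -/
def symMat (v : l ⊕ l → K) : Matrix (l ⊕ l) (l ⊕ l) K := vecMulVec v (J l K *ᵥ v)

theorem mem_sp {X : Matrix (l ⊕ l) (l ⊕ l) K} :
    X ∈ Symplectic.sp l K ↔ Xᵀ * J l K = J l K * (-X) := by
  rw [Symplectic.sp, mem_skewAdjointMatricesLieSubalgebra, mem_skewAdjointMatricesSubmodule]
  rfl

theorem vecMul_J (v : l ⊕ l → K) : v ᵥ* J l K = -(J l K *ᵥ v) := by
  rw [← mulVec_transpose, J_transpose, neg_mulVec]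

theorem symMat_mem (v : l ⊕ l → K) : symMat v ∈ Symplectic.sp l K := by
  rw [mem_sp, symMat, transpose_vecMulVec, vecMulVec_mul, mul_neg, mul_vecMulVec, vecMul_J,
    vecMulVec_neg]

theorem J_mulVec_dotProduct (v w : l ⊕ l → K) :
    (J l K *ᵥ v) ⬝ᵥ w = -((J l K *ᵥ w) ⬝ᵥ v) := by
  rw [dotProduct_comm, dotProduct_mulVec, vecMul_J, neg_dotProduct]

theorem J_mulVec_dotProduct_self (h2 : (2 : K) ≠ 0) (v : l ⊕ l → K) :
    (J l K *ᵥ v) ⬝ᵥ v = 0 := by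
  have : 2 * ((J l K *ᵥ v) ⬝ᵥ v) = 0 := by linear_combination J_mulVec_dotProduct v v
  exact (mul_eq_zero.1 this).resolve_left h2

theorem lie_lie_symMat (h2 : (2 : K) ≠ 0) (v : l ⊕ l → K) (X : Matrix (l ⊕ l) (l ⊕ l) K) :
    symMat v * (symMat v * X - X * symMat v) - (symMat v * X - X * symMat v) * symMat v =
      (-2 * ((J l K *ᵥ v) ⬝ᵥ X *ᵥ v)) • symMat v := by
  have e1 : symMat v * symMat v = 0 := by
    rw [symMat, vecMulVec_mul_vecMulVec, J_mulVec_dotProduct_self h2, zero_smul, vecMulVec_zero]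
  have e2 : symMat v * X * symMat v = ((J l K *ᵥ v) ⬝ᵥ X *ᵥ v) • symMat v := by
    rw [mul_assoc, symMat, mul_vecMulVec, vecMulVec_mul_vecMulVec, vecMulVec_smul]
  have : symMat v * (symMat v * X - X * symMat v) - (symMat v * X - X * symMat v) * symMat v =
      symMat v * symMat v * X - (2 : K) • (symMat v * X * symMat v)
        + X * (symMat v * symMat v) := by
    rw [two_smul]; noncomm_ring
  rw [this, e1, e2]
  simp [smul_smul]

theorem lie_lie_symMat_symMat (h2 : (2 : K) ≠ 0) (v w : l ⊕ l → K) :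
    symMat w * (symMat w * symMat v - symMat v * symMat w) -
      (symMat w * symMat v - symMat v * symMat w) * symMat w =
      (2 * ((J l K *ᵥ v) ⬝ᵥ w) ^ 2) • symMat w := by
  rw [lie_lie_symMat h2, symMat, vecMulVec_mulVec]
  congr 1
  simp
  rw [J_mulVec_dotProduct w v]
  ring

/-- `X ↦ X J` identifies the symplectic algebra with the symmetric matrices, which are spanned by
the squares `v vᵀ` through polarization. -/
theorem sp_le_of_symMat_mem (I : Submodule K (Matrix (l ⊕ l) (l ⊕ l) K)) (h2 : (2 : K) ≠ 0)
    (h : ∀ v, symMat v ∈ I) : (Symplectic.sp l K).toSubmodule ≤ I := by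
  intro X hX
  have hX := mem_sp.1 hX
  set Y := X * J l K with hY
  have hYt : Yᵀ = Y := by
    rw [hY, transpose_mul, J_transpose, neg_mul]
    have h1 : J l K * (Xᵀ * J l K) * J l K = J l K * (J l K * (-X)) * J l K := by rw [hX]
    simp only [← mul_assoc, J_squared] at h1
    rw [mul_assoc (J l K * Xᵀ), J_squared] at h1
    simpa using h1
  have hXY : X = -(Y * J l K) := by
    rw [hY, mul_assoc, J_squared, mul_neg, mul_one, neg_neg]
  have hsym : ∀ v : l ⊕ l → K, symMat v = -(vecMulVec v v * J l K) := by
    intro v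
    rw [vecMulVec_mul, vecMul_J, vecMulVec_neg, neg_neg, symMat]
  have key : (2 : K) • X = ∑ i, ∑ j, Y i j •
      (symMat (Pi.single i (1 : K) + Pi.single j 1) - symMat (Pi.single i (1 : K))
        - symMat (Pi.single j (1 : K))) := by
    have e : ∀ i j, Y i j •
      (symMat (Pi.single i (1 : K) + Pi.single j 1) - symMat (Pi.single i (1 : K))
        - symMat (Pi.single j (1 : K))) =
        -((single i j (Y i j) + single j i (Y i j)) * J l K) := by
      intro i j
      rw [hsym, hsym, hsym]
      simp only [add_vecMulVec, vecMulVec_add, ← single_eq_single_vecMulVec_single]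
      rw [← mul_one (Y i j), ← smul_eq_mul, ← smul_single, ← smul_single]
      simp only [add_mul, smul_mul_assoc]
      module
    simp_rw [e, Finset.sum_neg_distrib, ← Finset.sum_mul, Finset.sum_add_distrib]
    rw [Finset.sum_comm (f := fun i j => single j i (Y i j)), ← Matrix.matrix_eq_sum_single Y]
    have : ∑ j, ∑ i, single j i (Y i j) = Yᵀ := by
      conv_rhs => rw [Matrix.matrix_eq_sum_single Yᵀ]
      rfl
    rw [this, hYt, add_mul, neg_add, ← hXY, two_smul]
  rw [← I.smul_mem_iff h2, key]
  exact Submodule.sum_mem _ fun i _ => Submodule.sum_mem _ fun j _ => I.smul_mem _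
    (I.sub_mem (I.sub_mem (h _) (h _)) (h _))

/-- For `X ≠ 0` the quadratic form `v ↦ (J v) ⬝ᵥ X v` is nonzero by polarization, so
`lie_lie_symMat` puts some `symMat v` into the ideal. By `lie_lie_symMat_symMat` membership spreads
from `v` to every `w` not symplectically orthogonal to it, and to the other `w` through an
intermediate vector `u`. -/
theorem isSimple_sp [CharZero K] [Nonempty l] : IsSimple K (Symplectic.sp l K) := by
  have h2 : (2 : K) ≠ 0 := two_ne_zero
  have hex : ∀ v : l ⊕ l → K, v ≠ 0 → ∃ u : l ⊕ l → K, (J l K *ᵥ v) ⬝ᵥ u ≠ 0 := by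
    intro v hv
    by_contra! h
    have h0 : J l K *ᵥ v = 0 := dotProduct_eq_zero _ h
    have : J l K *ᵥ (J l K *ᵥ v) = -v := by
      rw [mulVec_mulVec, J_squared, neg_mulVec, one_mulVec]
    rw [h0, mulVec_zero] at this
    exact hv (neg_eq_zero.1 this.symm)
  obtain ⟨i⟩ := ‹Nonempty l›
  refine isSimple_of_forall_submodule _ ?_ ?_
  · obtain ⟨u, hu⟩ := hex (Pi.single (Sum.inl i) 1) (by simp)
    refine ⟨_, symMat_mem u, _, symMat_mem (Pi.single (Sum.inl i) 1), fun h => ?_⟩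
    have h1 := lie_lie_symMat_symMat h2 (Pi.single (Sum.inl i) (1 : K)) u
    rw [h, sub_self, mul_zero, zero_mul, sub_self, eq_comm, smul_eq_zero] at h1
    rcases h1 with h1 | h1
    · exact mul_ne_zero h2 (pow_ne_zero 2 hu) h1
    · rw [symMat, vecMulVec_eq_zero] at h1
      rcases h1 with h1 | h1
      · simp [h1] at hu
      · rw [J_mulVec_dotProduct, h1] at hu
        simp at hu
  rintro I hIA hI ⟨X, hX, hX0⟩
  have hXs := mem_sp.1 (hIA hX)
  have hsym : ∀ x y, (J l K *ᵥ x) ⬝ᵥ X *ᵥ y = (J l K *ᵥ y) ⬝ᵥ X *ᵥ x := by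
    intro x y
    rw [dotProduct_mulVec, ← mulVec_transpose, mulVec_mulVec, hXs, ← mulVec_mulVec, neg_mulVec,
      mulVec_neg, neg_dotProduct, ← J_mulVec_dotProduct]
  obtain ⟨v, hv⟩ : ∃ v : l ⊕ l → K, (J l K *ᵥ v) ⬝ᵥ X *ᵥ v ≠ 0 := by
    by_contra! h
    have h0 : ∀ x y, (J l K *ᵥ x) ⬝ᵥ X *ᵥ y = 0 := by
      intro x y
      have h1 := h (x + y)
      simp only [mulVec_add, add_dotProduct, dotProduct_add, h, hsym x y] at h1
      have : 2 * ((J l K *ᵥ y) ⬝ᵥ X *ᵥ x) = 0 := by linear_combination h1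
      rw [hsym, (mul_eq_zero.1 this).resolve_left h2]
    refine hX0 ?_
    have hX1 : ∀ y, X *ᵥ y = 0 := by
      intro y
      by_contra hne
      obtain ⟨u, hu⟩ := hex _ hne
      rw [J_mulVec_dotProduct, h0, neg_zero] at hu
      exact hu rfl
    exact Matrix.ext_of_mulVec_single fun i => by rw [hX1, zero_mulVec]
  have hvI : symMat v ∈ I := by
    have h1 := hI _ (symMat_mem v) _ (hI _ (symMat_mem v) _ hX)
    rw [lie_lie_symMat h2] at h1
    exact (I.smul_mem_iff (mul_ne_zero (neg_ne_zero.2 h2) hv)).1 h1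
  have step : ∀ x y, symMat x ∈ I → (J l K *ᵥ x) ⬝ᵥ y ≠ 0 → symMat y ∈ I := by
    intro x y hx hxy
    have h1 := hI _ (symMat_mem y) _ (hI _ (symMat_mem y) _ hx)
    rw [lie_lie_symMat_symMat h2] at h1
    exact (I.smul_mem_iff (mul_ne_zero h2 (pow_ne_zero 2 hxy))).1 h1
  refine sp_le_of_symMat_mem I h2 fun w => ?_
  by_cases hw : w = 0
  · rw [hw, symMat, zero_vecMulVec]; exact zero_mem _
  have hv0 : v ≠ 0 := by rintro rfl; simp at hv
  by_cases hvw : (J l K *ᵥ v) ⬝ᵥ w = 0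
  · obtain ⟨a, ha⟩ := hex v hv0
    obtain ⟨b, hb⟩ := hex w hw
    obtain ⟨u, hu, hu'⟩ : ∃ u, (J l K *ᵥ v) ⬝ᵥ u ≠ 0 ∧ (J l K *ᵥ w) ⬝ᵥ u ≠ 0 := by
      by_cases hwa : (J l K *ᵥ w) ⬝ᵥ a = 0
      · by_cases hvb : (J l K *ᵥ v) ⬝ᵥ b = 0
        · exact ⟨a + b, by simpa [hvb] using ha, by simpa [hwa] using hb⟩
        · exact ⟨b, hvb, hb⟩
      · exact ⟨a, ha, hwa⟩
    refine step u w (step v u hvI hu) ?_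
    rw [J_mulVec_dotProduct]
    exact neg_ne_zero.2 hu'
  · exact step v w hvI hvw

end Symplectic

end ClassicalSimple

/-! ### Lower bounds for the dimensions -/

namespace ClassicalSimple

open Matrix LieAlgebra Module

attribute [local instance] LieRing.ofAssociativeRing

theorem le_finrank_sl {n : Type*} [Fintype n] [DecidableEq n] (hn : 4 ≤ Fintype.card n) :
    15 ≤ finrank ℂ (SpecialLinear.sl n ℂ) := by
  have h1 := LinearMap.finrank_range_add_finrank_ker (Matrix.traceLinearMap n ℂ ℂ)
  have h2 : finrank ℂ (LinearMap.range (Matrix.traceLinearMap n ℂ ℂ)) ≤ 1 :=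
    (Submodule.finrank_le _).trans (finrank_self ℂ).le
  have h3 : finrank ℂ (LinearMap.ker (Matrix.traceLinearMap n ℂ ℂ)) =
    finrank ℂ (SpecialLinear.sl n ℂ) := rfl
  rw [finrank_matrix, finrank_self, mul_one] at h1
  nlinarith

theorem le_finrank_so {m : ℕ} (hm : 6 ≤ m) : 15 ≤ finrank ℂ (Orthogonal.so (Fin m) ℂ) := by
  let f : ({p : Fin m × Fin m // p.1 < p.2} → ℂ) →ₗ[ℂ] Matrix (Fin m) (Fin m) ℂ :=
    { toFun c := Matrix.of fun i j => if h : i < j then c ⟨(i, j), h⟩ else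
        if h : j < i then -c ⟨(j, i), h⟩ else 0
      map_add' c c' := by
        ext i j
        simp only [Matrix.of_apply, Matrix.add_apply, Pi.add_apply]
        split_ifs <;> ring
      map_smul' a c := by
        ext i j
        simp only [Matrix.of_apply, Matrix.smul_apply, Pi.smul_apply, smul_eq_mul,
          RingHom.id_apply]
        split_ifs <;> ring }
  have hf : ∀ c, f c ∈ (Orthogonal.so (Fin m) ℂ).toSubmodule := by
    intro c
    refine (Orthogonal.mem_so _ ℂ _).2 ?_
    ext i j
    simp only [f, LinearMap.coe_mk, AddHom.coe_mk, transpose_apply, Matrix.neg_apply, of_apply]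
    rcases lt_trichotomy i j with h | h | h
    · simp [h, h.not_gt]
    · simp [h]
    · simp [h, h.not_gt]
  have hinj : Function.Injective (f.codRestrict _ hf) := by
    intro c c' h
    ext ⟨⟨i, j⟩, hij⟩
    have := congrFun (congrFun (congrArg Subtype.val h) i) j
    simpa [f, show i < j from hij] using this
  have h1 := LinearMap.finrank_le_finrank_of_injective hinj
  rw [finrank_fintype_fun_eq_card] at h1
  refine le_trans ?_ h1
  have h2 : Fintype.card {p : Fin 6 × Fin 6 // p.1 < p.2} = 15 := by decide
  rw [← h2]
  refine Fintype.card_le_of_injective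
    (fun p => ⟨(Fin.castLE hm p.1.1, Fin.castLE hm p.1.2), p.2⟩) ?_
  rintro ⟨⟨i, j⟩, h⟩ ⟨⟨i', j'⟩, h'⟩ he
  simpa [Fin.ext_iff] using he

/-- Diagonal matrices in place of all symmetric off-diagonal blocks already give `9 + 3 + 3 = 15`
when the rank is three. -/
theorem le_finrank_sp {l : Type*} [Fintype l] [DecidableEq l] (hl : 3 ≤ Fintype.card l) :
    15 ≤ finrank ℂ (Symplectic.sp l ℂ) := by
  let f : (Matrix l l ℂ × (l → ℂ) × (l → ℂ)) →ₗ[ℂ] Matrix (l ⊕ l) (l ⊕ l) ℂ :=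
    { toFun c := fromBlocks c.1 (diagonal c.2.1) (diagonal c.2.2) (-c.1ᵀ)
      map_add' c c' := by
        simp [fromBlocks_add, add_comm]
      map_smul' a c := by
        simp [fromBlocks_smul, diagonal_smul] }
  have hf : ∀ c, f c ∈ (Symplectic.sp l ℂ).toSubmodule := by
    intro c
    refine mem_sp.2 ?_
    simp [f, J, fromBlocks_transpose, fromBlocks_multiply, fromBlocks_neg]
  have hinj : Function.Injective (f.codRestrict _ hf) := by
    rintro ⟨a, b, c⟩ ⟨a', b', c'⟩ h
    have := congrArg Subtype.val h
    simp only [f, LinearMap.codRestrict_apply, LinearMap.coe_mk, AddHom.coe_mk,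
      fromBlocks_inj, diagonal_injective.eq_iff] at this
    rw [this.1, this.2.1, this.2.2.1]
  have h1 := LinearMap.finrank_le_finrank_of_injective hinj
  rw [finrank_prod, finrank_prod, finrank_matrix, finrank_fintype_fun_eq_card, finrank_self] at h1
  change 15 ≤ finrank ℂ (Symplectic.sp l ℂ).toSubmodule
  nlinarith

end ClassicalSimple

/-! ### Descent of simplicity and dimension to real forms -/

namespace SplitLie

open LieAlgebra Module

variable {𝔤 : Type*} [LieRing 𝔤] [LieAlgebra ℝ 𝔤] {𝔩 : Type*} [LieRing 𝔩] [LieAlgebra ℂ 𝔩]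

theorem IsRealForm.finite [Module.Finite ℂ 𝔩] (h : IsRealForm 𝔤 𝔩) : Module.Finite ℝ 𝔤 := by
  obtain ⟨e⟩ := h
  have : Module.Finite ℂ (ℂ ⊗[ℝ] 𝔤) := Module.Finite.equiv e.toLinearEquiv.symm
  exact Module.Finite.of_finite_tensorProduct_of_faithfullyFlat ℂ

theorem IsRealForm.finrank_eq (h : IsRealForm 𝔤 𝔩) : finrank ℝ 𝔤 = finrank ℂ 𝔩 := by
  obtain ⟨e⟩ := h
  rw [← e.toLinearEquiv.finrank_eq, Module.finrank_baseChange]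

/-- The complexification of an ideal `I` is an ideal, hence zero or everything. If zero, `I = 0` by
faithful flatness. If everything, `I` is the whole algebra: otherwise a functional vanishing on `I`
but not at some `x` extends to one separating `1 ⊗ x` from the complexified ideal. -/
theorem IsRealForm.isSimple [IsSimple ℂ 𝔩] (h : IsRealForm 𝔤 𝔩) : IsSimple ℝ 𝔤 := by
  obtain ⟨e⟩ := h
  constructor
  · intro I
    set B : LieIdeal ℂ (ℂ ⊗[ℝ] 𝔤) := I.baseChange ℂ with hB
    have key : ∀ x : 𝔤, x ∈ I → e (1 ⊗ₜ x) ∈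
        LieIdeal.comap (e.symm : 𝔩 →ₗ⁅ℂ⁆ ℂ ⊗[ℝ] 𝔤) B := by
      intro x hx
      rw [LieIdeal.mem_comap]
      simpa using LieSubmodule.tmul_mem_baseChange_of_mem (1 : ℂ) hx
    rcases IsSimple.eq_bot_or_eq_top (R := ℂ)
      (LieIdeal.comap (e.symm : 𝔩 →ₗ⁅ℂ⁆ ℂ ⊗[ℝ] 𝔤) B) with h | h
    · left
      rw [LieSubmodule.eq_bot_iff]
      intro x hx
      have h1 := key x hx
      rw [h, LieSubmodule.mem_bot] at h1
      have h2 : (1 : ℂ) ⊗ₜ[ℝ] x = 0 := e.injective (h1.trans (map_zero e).symm)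
      refine Module.FaithfullyFlat.tensorProduct_mk_injective (A := ℝ) (B := ℂ) 𝔤 ?_
      simpa using h2
    · right
      by_contra hI
      obtain ⟨x, hx⟩ : ∃ x, x ∉ I := by
        by_contra! hc
        exact hI (eq_top_iff.2 fun x _ => hc x)
      obtain ⟨φ, hφx, hφ⟩ := Submodule.exists_le_ker_of_notMem (p := I.toSubmodule) hx
      have h1 : e (1 ⊗ₜ x) ∈ LieIdeal.comap (e.symm : 𝔩 →ₗ⁅ℂ⁆ ℂ ⊗[ℝ] 𝔤) B := by
        rw [h]; trivial
      rw [LieIdeal.mem_comap] at h1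
      have h2 : (1 : ℂ) ⊗ₜ[ℝ] x ∈ (I.toSubmodule).baseChange ℂ := by
        have h2 : (1 : ℂ) ⊗ₜ[ℝ] x ∈ B := by simpa using h1
        exact h2
      have h3 : (I.toSubmodule).baseChange ℂ ≤ LinearMap.ker (φ.baseChange ℂ) := by
        rw [Submodule.baseChange_eq_span, Submodule.span_le]
        rintro _ ⟨y, hy, rfl⟩
        have : φ y = 0 := hφ hy
        simp [this]
      have h4 : φ.baseChange ℂ ((1 : ℂ) ⊗ₜ[ℝ] x) = 0 := h3 h2
      rw [LinearMap.baseChange_tmul] at h4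
      refine hφx (Module.FaithfullyFlat.tensorProduct_mk_injective (A := ℝ) (B := ℂ) ℝ ?_)
      simpa using h4
  · intro hab
    refine IsSimple.non_abelian ℂ (L := 𝔩) ((lie_abelian_iff_equiv_lie_abelian e).1 ⟨fun x y => ?_⟩)
    induction x with
    | zero => simp
    | add a b ha hb => rw [add_lie, ha, hb, add_zero]
    | tmul a x =>
      induction y with
      | zero => simp
      | add c d hc hd => rw [lie_add, hc, hd, add_zero]
      | tmul c y => rw [LieAlgebra.ExtendScalars.bracket_tmul, hab.trivial, TensorProduct.tmul_zero]

theorem isSimple_of_isRealForm_classical {n : ℕ}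
    (h𝔤 : (3 ≤ n ∧ IsRealForm 𝔤 (SpecialLinear.sl (Fin (n + 1)) ℂ)) ∨
      (3 ≤ n ∧ IsRealForm 𝔤 (Orthogonal.so (Fin (2 * n + 1)) ℂ)) ∨
      (3 ≤ n ∧ IsRealForm 𝔤 (Symplectic.sp (Fin n) ℂ)) ∨
      (4 ≤ n ∧ IsRealForm 𝔤 (Orthogonal.so (Fin (2 * n)) ℂ))) :
    Module.Finite ℝ 𝔤 ∧ IsSimple ℝ 𝔤 ∧ 15 ≤ finrank ℝ 𝔤 := by
  rcases h𝔤 with ⟨hn, h⟩ | ⟨hn, h⟩ | ⟨hn, h⟩ | ⟨hn, h⟩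
  · have := ClassicalSimple.isSimple_sl (K := ℂ) (n := Fin (n + 1)) (by simp; omega)
    exact ⟨h.finite, h.isSimple,
      h.finrank_eq ▸ ClassicalSimple.le_finrank_sl (by simp; omega)⟩
  · have := ClassicalSimple.isSimple_so (n := Fin (2 * n + 1)) (by simp; omega)
    exact ⟨h.finite, h.isSimple, h.finrank_eq ▸ ClassicalSimple.le_finrank_so (by omega)⟩
  · have : Nonempty (Fin n) := ⟨⟨0, by omega⟩⟩
    have := ClassicalSimple.isSimple_sp (K := ℂ) (l := Fin n)
    exact ⟨h.finite, h.isSimple, h.finrank_eq ▸ ClassicalSimple.le_finrank_sp (by simpa)⟩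
  · have := ClassicalSimple.isSimple_so (n := Fin (2 * n)) (by simp; omega)
    exact ⟨h.finite, h.isSimple, h.finrank_eq ▸ ClassicalSimple.le_finrank_so (by omega)⟩

end SplitLie

/-! ### Maximal roots, and the root count in rank at most two -/

namespace RootPairing.Base

open Module

variable {ι R M N : Type*} [Field R] [CharZero R] [AddCommGroup M] [Module R M]
  [AddCommGroup N] [Module R N] {P : RootPairing ι R M N} [Finite ι] [P.IsCrystallographic]

/-- Expansion of the pairing with respect to a base. -/
theorem pairingIn_eq_sum {s : Finset ι} {i : ι} {f : ι → ℤ}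
    (h : P.root i = ∑ j ∈ s, f j • P.root j) (k : ι) :
    P.pairingIn ℤ i k = ∑ j ∈ s, f j * P.pairingIn ℤ j k := by
  apply FaithfulSMul.algebraMap_injective ℤ R
  rw [map_sum, algebraMap_pairingIn, ← root_coroot_eq_pairing, h, map_sum, LinearMap.sum_apply]
  refine Finset.sum_congr rfl fun j _ => ?_
  rw [map_zsmul, LinearMap.smul_apply, root_coroot_eq_pairing, map_mul, algebraMap_pairingIn,
    zsmul_eq_mul]
  simp

theorem IsPos.exists_nat_coeff {b : P.Base} {i : ι} (h : b.IsPos i) :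
    ∃ f : ι → ℤ, (∀ j, 0 ≤ f j) ∧ (∀ j ∉ b.support, f j = 0) ∧
      P.root i = ∑ j ∈ b.support, f j • P.root j := by
  obtain ⟨f, hf₀, hf₁, hf₂⟩ := b.exists_root_eq_sum_int i
  have hf₁ : 0 < f := by
    refine hf₁.resolve_right fun hneg => ?_
    rw [isPos_iff, height_eq_sum hf₂] at h
    exact absurd (Finset.sum_nonpos fun j _ => hneg.le j) h.not_ge
  refine ⟨f, hf₁.le, fun j hj => ?_, hf₂⟩
  by_contra hne
  exact hj (hf₀ hne)

theorem coeff_unique {b : P.Base} {f g : ι → ℤ}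
    (h : ∑ j ∈ b.support, f j • P.root j = ∑ j ∈ b.support, g j • P.root j) {j : ι}
    (hj : j ∈ b.support) : f j = g j := by
  have hli := linearIndepOn_finset_iff.1 b.linearIndepOn_root (fun j => ((f j - g j : ℤ) : R)) ?_ j hj
  · exact sub_eq_zero.1 (Int.cast_eq_zero.1 hli)
  · simp_rw [Int.cast_smul_eq_zsmul, sub_smul]
    rw [Finset.sum_sub_distrib, h, sub_self]

variable [P.IsReduced]

theorem pairingIn_nonneg_of_add_notMem {b : P.Base} {i j : ι} (hi : b.IsPos i)
    (hj : j ∈ b.support) (h : P.root i + P.root j ∉ Set.range P.root) :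
    0 ≤ P.pairingIn ℤ i j := by
  by_contra! hc
  refine h (P.root_add_root_mem_of_pairingIn_neg hc fun he => ?_)
  have h2 : b.height (P.reflectionPerm j j) = -b.height j := b.height_reflectionPerm_self j
  have : i = P.reflectionPerm j j := by
    apply P.root.injective
    rw [root_reflectionPerm, reflection_apply_self, he]
  rw [isPos_iff, this, h2, height_one_of_mem_support hj] at hi
  omega

/-- In an irreducible root system, a maximal root involves all simple roots. -/
theorem coeff_pos_of_maximal [P.IsIrreducible] {b : P.Base} {i : ι} (hi : b.IsPos i)
    (hmax : ∀ j ∈ b.support, P.root i + P.root j ∉ Set.range P.root) {f : ι → ℤ}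
    (hf : ∀ j, 0 ≤ f j) (h : P.root i = ∑ j ∈ b.support, f j • P.root j)
    {j : ι} (hj : j ∈ b.support) : 0 < f j := by
  by_contra hj0
  have hj0 : f j = 0 := le_antisymm (not_lt.1 hj0) (hf j)
  set J : Set ι := {k | k ∈ b.support ∧ f k ≠ 0} with hJ
  -- For a simple root `l` outside the support `J` of the root, its pairing with the root is
  -- nonnegative by maximality, but is also a sum of nonpositive terms; so every term vanishes. The
  -- span of `J` is then invariant under all reflections, and irreducibility forces it to be
  -- everything.
  have horth : ∀ k ∈ J, ∀ l ∈ b.support, l ∉ J → P.pairingIn ℤ k l = 0 := by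
    intro k hk l hl hlJ
    have hl0 : f l = 0 := by
      by_contra hne
      exact hlJ ⟨hl, hne⟩
    have h1 := pairingIn_nonneg_of_add_notMem hi hl (hmax l hl)
    rw [pairingIn_eq_sum h] at h1
    have h2 : ∀ m ∈ b.support, f m * P.pairingIn ℤ m l ≤ 0 := by
      intro m hm
      by_cases hml : m = l
      · rw [hml, hl0, zero_mul]
      · exact mul_nonpos_of_nonneg_of_nonpos (hf m) (b.pairingIn_le_zero_of_ne hml hm hl)
    have h3 := (Finset.sum_eq_zero_iff_of_nonpos h2).1
      (le_antisymm (Finset.sum_nonpos h2) h1) k hk.1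
    exact (mul_eq_zero.1 h3).resolve_left hk.2
  have hinv : ∀ k, Submodule.span R (P.root '' J) ∈ End.invtSubmodule (P.reflection k) := by
    rw [← b.forall_mem_support_invtSubmodule_iff]
    intro k hk
    rw [End.mem_invtSubmodule, Submodule.span_le]
    rintro _ ⟨l, hl, rfl⟩
    have e : P.reflection k (P.root l) = P.root l - P.pairing l k • P.root k :=
      P.reflection_apply_root k l
    change P.reflection k (P.root l) ∈ Submodule.span R (P.root '' J)
    rw [e]
    refine Submodule.sub_mem _ (Submodule.subset_span ⟨l, hl, rfl⟩) ?_
    by_cases hkJ : k ∈ J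
    · exact Submodule.smul_mem _ _ (Submodule.subset_span ⟨k, hkJ, rfl⟩)
    · rw [← P.algebraMap_pairingIn ℤ, horth l hl k hk hkJ, map_zero, zero_smul]
      exact zero_mem _
  have hne : Submodule.span R (P.root '' J) ≠ ⊥ := by
    intro hbot
    have h0 : P.root i = 0 := by
      rw [h]
      refine Finset.sum_eq_zero fun k hk => ?_
      by_cases hk0 : f k = 0
      · rw [hk0, zero_smul]
      · have : P.root k ∈ Submodule.span R (P.root '' J) :=
          Submodule.subset_span ⟨k, ⟨hk, hk0⟩, rfl⟩
        rw [hbot, Submodule.mem_bot] at this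
        rw [this, smul_zero]
    exact P.ne_zero i h0
  have htop := IsIrreducible.eq_top_of_invtSubmodule_reflection (P := P) _ hinv hne
  have hjJ : j ∉ J := fun h => h.2 hj0
  have hli : LinearIndepOn R P.root (insert j J) :=
    b.linearIndepOn_root.mono (Set.insert_subset hj fun k hk => hk.1)
  exact hli.notMem_span_of_insert hjJ (htop ▸ Submodule.mem_top)

/-- A maximal root is the sum of two positive roots different from a given simple root. -/
theorem exists_add_of_maximal [P.IsIrreducible] {b : P.Base} (hb : 3 ≤ b.support.card) {i : ι}
    (hi : b.IsPos i) (hmax : ∀ j ∈ b.support, P.root i + P.root j ∉ Set.range P.root)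
    {a : ι} (ha : a ∈ b.support) :
    ∃ j k, b.IsPos j ∧ b.IsPos k ∧ j ≠ a ∧ k ≠ a ∧ P.root i = P.root j + P.root k := by
  obtain ⟨f, hf, -, hfi⟩ := hi.exists_nat_coeff
  have hfpos : ∀ j ∈ b.support, 0 < f j := fun j => coeff_pos_of_maximal hi hmax hf hfi
  classical
  -- Reflection in `a` changes only the coefficient at `a`. The positive coefficients at `c` and `d`
  -- therefore survive in the reflected root, which is too large to be simple or a sum of `a` and
  -- one other simple root.
  obtain ⟨c, hc, d, hd, hcd⟩ : ∃ c ∈ b.support.erase a, ∃ d ∈ b.support.erase a, c ≠ d :=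
    Finset.one_lt_card.1 (by rw [Finset.card_erase_of_mem ha]; omega)
  have hia : i ≠ a := by
    rintro rfl
    have h1 : b.height i = ∑ j ∈ b.support, f j := b.height_eq_sum hfi
    rw [height_one_of_mem_support ha] at h1
    have h2 := Finset.sum_le_sum_of_subset_of_nonneg (f := f)
      (show ({c, d} : Finset ι) ⊆ b.support from by
        intro x hx
        simp only [Finset.mem_insert, Finset.mem_singleton] at hx
        rcases hx with rfl | rfl
        exacts [Finset.mem_of_mem_erase hc, Finset.mem_of_mem_erase hd]) fun j _ _ => hf j
    rw [Finset.sum_pair hcd] at h2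
    have := hfpos c (Finset.mem_of_mem_erase hc)
    have := hfpos d (Finset.mem_of_mem_erase hd)
    omega
  -- the reflected root
  set i' := P.reflectionPerm a i with hi'
  have hpos' : b.IsPos i' := hi.reflectionPerm ha hia
  have hrefl : ∀ k, P.root (P.reflectionPerm a k) = P.reflection a (P.root k) := fun k =>
    P.root_reflectionPerm a k
  have hroot' : P.root i' = P.root i - P.pairingIn ℤ i a • P.root a := by
    rw [hi', hrefl, reflection_apply_root' ℤ]
  have hsub : P.root i' - P.root a ∉ Set.range P.root := by
    rintro ⟨k, hk⟩
    refine hmax a ha ⟨P.reflectionPerm a k, ?_⟩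
    rw [hrefl, hk, map_sub, hi', hrefl, reflection_apply_self, reflection_same, sub_neg_eq_add]
  -- Split the reflected root as `m + k` with `m` simple. By `hsub`, `m` cannot be `a`, and the
  -- coefficients at `c` and `d` exclude `k = a`. Reflecting back gives the required decomposition.
  obtain ⟨m, hm, hmi⟩ := hpos'.exists_mem_support_pos_pairingIn
  rw [P.zero_lt_pairingIn_iff'] at hmi
  obtain ⟨f', hf', -, hfi'⟩ := hpos'.exists_nat_coeff
  have hcoeff : ∀ j ∈ b.support, j ≠ a → f' j = f j := by
    intro j hj hja
    have : ∑ j ∈ b.support, f' j • P.root j =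
        ∑ j ∈ b.support, (f j - if j = a then P.pairingIn ℤ i a else 0) • P.root j := by
      rw [← hfi', hroot', hfi]
      simp_rw [sub_smul, Finset.sum_sub_distrib, ite_smul, zero_smul]
      rw [Finset.sum_ite_eq' _ a, if_pos ha, ← hfi]
    have := coeff_unique this hj
    rwa [if_neg hja, sub_zero] at this
  have hheight : b.height i' = ∑ j ∈ b.support, f' j := b.height_eq_sum hfi'
  have hi'm : i' ≠ m := by
    rintro h
    rw [h, height_one_of_mem_support hm] at hheight
    have h2 := Finset.sum_le_sum_of_subset_of_nonneg (f := f')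
      (show ({c, d} : Finset ι) ⊆ b.support from by
        intro x hx
        simp only [Finset.mem_insert, Finset.mem_singleton] at hx
        rcases hx with rfl | rfl
        exacts [Finset.mem_of_mem_erase hc, Finset.mem_of_mem_erase hd]) fun j _ _ => hf' j
    rw [Finset.sum_pair hcd, hcoeff c (Finset.mem_of_mem_erase hc) (Finset.ne_of_mem_erase hc),
      hcoeff d (Finset.mem_of_mem_erase hd) (Finset.ne_of_mem_erase hd)] at h2
    have := hfpos c (Finset.mem_of_mem_erase hc)
    have := hfpos d (Finset.mem_of_mem_erase hd)
    omega
  obtain ⟨k, hk⟩ := P.root_sub_root_mem_of_pairingIn_pos hmi hi'm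
  have hkpos : b.IsPos k := hpos'.sub hm hk
  have hma : m ≠ a := by
    rintro rfl
    exact hsub ⟨k, hk⟩
  have hka : k ≠ a := by
    rintro rfl
    have h1 : ∑ j ∈ b.support, f' j • P.root j =
        ∑ j ∈ b.support, ((if j = m then 1 else 0) + if j = k then 1 else 0 : ℤ) • P.root j := by
      rw [← hfi', eq_add_of_sub_eq hk.symm]
      simp_rw [add_smul, Finset.sum_add_distrib, ite_smul, zero_smul, one_smul]
      rw [Finset.sum_ite_eq' _ m, Finset.sum_ite_eq' _ k, if_pos ha, if_pos hm, add_comm]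
    obtain ⟨e, he, hem⟩ : ∃ e ∈ b.support.erase k, e ≠ m := by
      by_cases hcm : c = m
      · exact ⟨d, hd, fun h => hcd (hcm.trans h.symm)⟩
      · exact ⟨c, hc, hcm⟩
    have h2 := coeff_unique h1 (Finset.mem_of_mem_erase he)
    rw [if_neg hem, if_neg (Finset.ne_of_mem_erase he),
      hcoeff e (Finset.mem_of_mem_erase he) (Finset.ne_of_mem_erase he)] at h2
    have := hfpos e (Finset.mem_of_mem_erase he)
    omega
  -- Only the negative root `-a` is reflected to `a`.
  have hne : ∀ l, b.IsPos l → P.reflectionPerm a l ≠ a := by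
    intro l hl h
    have h1 : b.height (P.reflectionPerm a a) = -b.height a := b.height_reflectionPerm_self a
    rw [show P.reflectionPerm a a = l by rw [← P.reflectionPerm_self a l, h],
      height_one_of_mem_support ha] at h1
    rw [isPos_iff] at hl
    omega
  refine ⟨P.reflectionPerm a m, P.reflectionPerm a k,
    (isPos_of_mem_support hm).reflectionPerm ha hma, hkpos.reflectionPerm ha hka,
    hne m (isPos_of_mem_support hm), hne k hkpos, ?_⟩
  rw [hrefl, hrefl, ← map_add, hk, add_sub_cancel, hi', hrefl, reflection_same]

/-- The lattice points that can occur as the coefficients of a root in rank at most two. -/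
noncomputable def rankTwoCoeffs (x y : ℤ) : Finset (ℤ × ℤ) :=
  (Finset.Icc (-4) 4 ×ˢ Finset.Icc (-4) 4).filter fun p =>
    (-2 ≤ 2 * p.1 + x * p.2 ∧ 2 * p.1 + x * p.2 ≤ 2) ∧
    (-2 ≤ y * p.1 + 2 * p.2 ∧ y * p.1 + 2 * p.2 ≤ 2) ∧
    (-2 ≤ (2 * p.1 + x * p.2) - (y * p.1 + 2 * p.2) * x ∧
      (2 * p.1 + x * p.2) - (y * p.1 + 2 * p.2) * x ≤ 2) ∧
    (-2 ≤ (y * p.1 + 2 * p.2) - (2 * p.1 + x * p.2) * y ∧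
      (y * p.1 + 2 * p.2) - (2 * p.1 + x * p.2) * y ≤ 2)

/-- An irreducible root system of rank at most two has at most twelve roots. -/
theorem card_le_twelve [P.IsIrreducible] {b : P.Base} (hb : b.support.card ≤ 2) :
    Nat.card ι ≤ 12 := by
  classical
  -- Type `G₂` attains twelve. Outside it all pairings lie between `-2` and `2`, which leaves
  -- finitely many coefficient vectors.
  by_cases hG : P.IsG2
  · have : P.EmbeddedG2 := IsG2.toEmbeddedG2 P
    exact (EmbeddedG2.card_index_eq_twelve P).le
  have hN : P.IsNotG2 := (not_isG2_iff_isNotG2 P).1 hG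
  have bound : ∀ i j, -2 ≤ P.pairingIn ℤ i j ∧ P.pairingIn ℤ i j ≤ 2 := by
    intro i j
    have := IsNotG2.pairingIn_mem_zero_one_two (P := P) i j
    simp only [Set.mem_insert_iff, Set.mem_singleton_iff] at this
    omega
  have hint : ∀ i, ∃ f : ι → ℤ, P.root i = ∑ j ∈ b.support, f j • P.root j := fun i =>
    let ⟨f, _, _, h⟩ := b.exists_root_eq_sum_int i
    ⟨f, h⟩
  choose f hf using hint
  rcases Nat.lt_or_ge b.support.card 2 with h1 | h2
  · have : Subsingleton b.support := by
      rw [← Finset.card_le_one_iff_subsingleton_coe]; omega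
    rcases isEmpty_or_nonempty ι with hι | hι
    · simp
    obtain ⟨a, ha⟩ := b.support_nonempty
    have hs : b.support = {a} := Finset.eq_singleton_iff_unique_mem.2
      ⟨ha, fun x hx => congrArg Subtype.val (Subsingleton.elim (⟨x, hx⟩ : b.support) ⟨a, ha⟩)⟩
    rw [hs] at hf
    simp only [Finset.sum_singleton] at hf
    have hinj : Function.Injective fun i => (⟨f i a, by
        have h1 := pairingIn_eq_sum (s := {a}) (i := i) (f := f i) (by simpa using hf i) a
        rw [Finset.sum_singleton, P.pairingIn_same] at h1
        have := bound i a
        rw [Finset.mem_Icc]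
        omega⟩ : Finset.Icc (-1 : ℤ) 1) := by
      intro i j hij
      apply P.root.injective
      rw [hf i, hf j, show f i a = f j a from congrArg Subtype.val hij]
    refine (Nat.card_le_card_of_injective _ hinj).trans ?_
    rw [Nat.card_eq_fintype_card, Fintype.card_coe]
    simp
  · obtain ⟨a, c, hac, hs⟩ := Finset.card_eq_two.1 (le_antisymm hb h2)
    have ha : a ∈ b.support := by simp [hs]
    have hc : c ∈ b.support := by simp [hs]
    have hp : ∀ i k, P.pairingIn ℤ i k = f i a * P.pairingIn ℤ a k + f i c * P.pairingIn ℤ c k := by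
      intro i k
      rw [pairingIn_eq_sum (hf i), hs, Finset.sum_pair hac]
    set x := P.pairingIn ℤ c a with hx
    set y := P.pairingIn ℤ a c with hy
    have hxy : (x = 0 ∧ y = 0) ∨ (x = -1 ∧ y = -1) ∨ (x = -1 ∧ y = -2) ∨ (x = -2 ∧ y = -1) := by
      have h1 := P.pairingIn_pairingIn_mem_set_of_isCrystal_of_isRed' a c
        (P.root.injective.ne hac) (b.root_ne_neg_of_ne ha hc hac)
      have h2 := b.pairingIn_le_zero_of_ne hac ha hc
      have h3 := bound a c
      have h4 := bound c a
      rw [← hy] at h2 h3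
      rw [← hx] at h4
      simp only [← hx, ← hy, Set.mem_insert_iff, Set.mem_singleton_iff, Prod.mk.injEq] at h1
      omega
    -- The four inequalities bound the pairings of the root with `a` and `c`, and those of its
    -- reflections in `c` and `a` with `a` and `c` respectively.
    have hmem : ∀ i, (f i a, f i c) ∈ rankTwoCoeffs x y := by
      intro i
      have e1 := hp i a
      have e2 := hp i c
      have e3 : ∀ j k, P.pairingIn ℤ (P.reflectionPerm j i) k =
          P.pairingIn ℤ i k - P.pairingIn ℤ i j * P.pairingIn ℤ j k := by
        intro j k
        rw [P.pairingIn_eq_add_of_root_eq_smul_add_smul (S := ℤ) (i := i) (l := j) (x := 1)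
          (y := -P.pairingIn ℤ i j)]
        · simp [sub_eq_add_neg]
        · rw [P.root_reflectionPerm, reflection_apply_root' ℤ]
          module
      have b1 := bound i a
      have b2 := bound i c
      have b3 := bound (P.reflectionPerm c i) a
      have b4 := bound (P.reflectionPerm a i) c
      rw [e3, ← hx] at b3
      rw [e3, ← hy] at b4
      rw [P.pairingIn_same, ← hx] at e1
      rw [P.pairingIn_same, ← hy] at e2
      rw [rankTwoCoeffs, Finset.mem_filter, Finset.mem_product, Finset.mem_Icc, Finset.mem_Icc]
      rw [e1, e2] at b3 b4
      rw [e1] at b1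
      rw [e2] at b2
      dsimp only
      clear_value x y
      rcases hxy with ⟨rfl, rfl⟩ | ⟨rfl, rfl⟩ | ⟨rfl, rfl⟩ | ⟨rfl, rfl⟩ <;> omega
    have hinj : Function.Injective fun i => (⟨_, hmem i⟩ : rankTwoCoeffs x y) := by
      intro i j hij
      have h1 := congrArg Subtype.val hij
      simp only [Prod.mk.injEq] at h1
      apply P.root.injective
      rw [hf i, hf j, hs, Finset.sum_pair hac, Finset.sum_pair hac, h1.1, h1.2]
    refine (Nat.card_le_card_of_injective _ hinj).trans ?_
    rw [Nat.card_eq_fintype_card, Fintype.card_coe]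
    rcases hxy with ⟨h1, h2⟩ | ⟨h1, h2⟩ | ⟨h1, h2⟩ | ⟨h1, h2⟩ <;> rw [h1, h2] <;> decide

end RootPairing.Base

/-! ### Closed two-forms and the canonical filtration -/

namespace LieForms

open Module

variable {L : Type*} [LieRing L] [LieAlgebra ℝ L]

theorem wedgeSq_mono {V W : Submodule ℝ (Dual ℝ L)} (h : V ≤ W) : wedgeSq V ≤ wedgeSq W :=
  Submodule.span_mono fun _ ⟨α, hα, β, hβ, e⟩ => ⟨α, h hα, β, h hβ, e⟩

/-- An alternating form whose radical contains `W` is a combination of wedge products of one-forms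
vanishing on `W`. -/
theorem mem_wedgeSq_dualAnnihilator [FiniteDimensional ℝ L] (W : Submodule ℝ L) {ω : Bilin L}
    (halt : ∀ x, ω x x = 0) (hW : ∀ z ∈ W, ∀ x, ω z x = 0) :
    ω ∈ wedgeSq W.dualAnnihilator := by
  have hskew : ∀ x y, ω x y = -ω y x := by
    intro x y
    have := halt (x + y)
    simp only [map_add, LinearMap.add_apply, halt] at this
    linarith
  obtain ⟨C, hC⟩ := W.exists_isCompl
  let p : L →ₗ[ℝ] C := C.projectionOnto W hC.symm
  have hp : ∀ z ∈ W, p z = 0 := fun z hz => by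
    have : z ∈ LinearMap.ker p := by simpa [p] using hz
    exact this
  have hωp : ∀ x y, ω x y = ω (p x) (p y) := by
    have h1 : ∀ x y, ω x y = ω (p x) y := by
      intro x y
      have hx : x - p x ∈ W := by
        have hker : LinearMap.ker p = W := C.ker_projectionOnto hC.symm
        rw [← hker, LinearMap.mem_ker, map_sub, sub_eq_zero]
        exact (C.projectionOnto_apply_left hC.symm (p x)).symm
      have := hW _ hx y
      rwa [map_sub, LinearMap.sub_apply, sub_eq_zero] at this
    intro x y
    rw [h1, hskew, h1, ← hskew]
  let c := finBasis ℝ C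
  let φ : Fin (finrank ℝ C) → Dual ℝ L := fun i => c.coord i ∘ₗ p
  have hφ : ∀ i, φ i ∈ W.dualAnnihilator := fun i => by
    rw [Submodule.mem_dualAnnihilator]
    intro z hz
    simp [φ, hp z hz]
  -- The form is pulled back along the projection `p` with kernel `W` and expanded in coordinates of
  -- the complement. The sum runs over ordered pairs, so each wedge occurs twice.
  have key : ω = (2⁻¹ : ℝ) • ∑ i, ∑ j, ω (c i) (c j) • wedge (φ i) (φ j) := by
    ext x y
    have e : ω x y = ∑ i, ∑ j, ω (c i) (c j) * (φ i x * φ j y) := by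
      have hx : (p x : L) = ∑ i, φ i x • (c i : L) := by
        have := congrArg C.subtype (c.sum_repr (p x))
        rw [map_sum] at this
        exact this.symm
      have hy : (p y : L) = ∑ i, φ i y • (c i : L) := by
        have := congrArg C.subtype (c.sum_repr (p y))
        rw [map_sum] at this
        exact this.symm
      rw [hωp, hx, hy]
      simp only [map_sum, LinearMap.sum_apply, map_smul, LinearMap.smul_apply, smul_eq_mul,
        Finset.mul_sum]
      rw [Finset.sum_comm]
      exact Finset.sum_congr rfl fun i _ => Finset.sum_congr rfl fun j _ => by ring
    have e' : ω x y = -∑ i, ∑ j, ω (c i) (c j) * (φ i y * φ j x) := by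
      rw [e, Finset.sum_comm, ← Finset.sum_neg_distrib]
      refine Finset.sum_congr rfl fun i _ => ?_
      rw [← Finset.sum_neg_distrib]
      refine Finset.sum_congr rfl fun j _ => ?_
      rw [hskew]; ring
    have e'' : ((2⁻¹ : ℝ) • ∑ i, ∑ j, ω (c i) (c j) • wedge (φ i) (φ j)) x y =
        2⁻¹ * ((∑ i, ∑ j, ω (c i) (c j) * (φ i x * φ j y)) -
          ∑ i, ∑ j, ω (c i) (c j) * (φ i y * φ j x)) := by
      simp only [LinearMap.smul_apply, LinearMap.sum_apply, smul_eq_mul, wedge,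
        LinearMap.mk₂_apply, ← Finset.sum_sub_distrib, mul_sub]
    rw [e'', ← e, sub_eq_add_neg, ← e']
    ring
  rw [key]
  exact Submodule.smul_mem _ _ (Submodule.sum_mem _ fun i _ => Submodule.sum_mem _ fun j _ =>
    Submodule.smul_mem _ _ (Submodule.subset_span ⟨_, hφ i, _, hφ j, rfl⟩))

/-- If `α` kills `[L, Lⁱ]`, then `Lⁱ` lies in the radical of `d α`, so `d α` is built from one-forms
vanishing on `Lⁱ`. -/
theorem dualAnnihilator_lowerCentralSeries_le_V [FiniteDimensional ℝ L] (i : ℕ) :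
    (LieModule.lowerCentralSeries ℝ L L i).toSubmodule.dualAnnihilator ≤ V L i := by
  induction i with
  | zero => simp [V]
  | succ i ih =>
    intro α hα
    rw [Submodule.mem_dualAnnihilator] at hα
    refine wedgeSq_mono ih (mem_wedgeSq_dualAnnihilator _ (fun x => ?_) fun z hz x => ?_)
    · simp [d₁]
    · change α ⁅z, x⁆ = 0
      rw [← lie_skew, map_neg, neg_eq_zero]
      refine hα _ ?_
      rw [LieModule.lowerCentralSeries_succ]
      exact LieSubmodule.lie_mem_lie (LieSubmodule.mem_top x) hz

/-- If all closed two-forms are killed by the contraction with the elements of the last nonzero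
term of the lower central series, then `E_∞^{0,2}` vanishes. -/
theorem subsingleton_EInf_zero [FiniteDimensional ℝ L]
    (h : ∀ ω ∈ closedTwoForms L,
      ∀ z ∈ LieModule.lowerCentralSeries ℝ L L (nilIndex L - 1), ∀ x, ω z x = 0) :
    Subsingleton (EInf L 0) := by
  rw [subsingleton_subquotient_iff]
  refine le_trans ?_ le_sup_right
  rintro ω ⟨-, hω⟩
  exact ⟨wedgeSq_mono (dualAnnihilator_lowerCentralSeries_le_V _)
    (mem_wedgeSq_dualAnnihilator _ hω.1 (h ω hω)), hω⟩

end LieForms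

/-! ### Lifting highest weight vectors for `sl₂` -/

namespace IsSl2Triple

open LieModule

variable {K L U W : Type*} [Field K] [CharZero K] [LieRing L] [LieAlgebra K L]
  [AddCommGroup U] [Module K U] [LieRingModule L U] [LieModule K L U]
  [AddCommGroup W] [Module K W] [LieRingModule L W] [LieModule K L W] {h e f : L}

theorem HasPrimitiveVectorWith.pow_toEnd_e_pow_toEnd_f {t : IsSl2Triple h e f} {v : U} {m : ℕ}
    (P : HasPrimitiveVectorWith t v (m : K)) {n : ℕ} (hn : n ≤ m) :
    ∃ c : K, c ≠ 0 ∧ (toEnd K L U e ^ n) ((toEnd K L U f ^ n) v) = c • v := by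
  induction n with
  | zero => exact ⟨1, one_ne_zero, by simp⟩
  | succ n ih =>
    obtain ⟨c, hc, h⟩ := ih (by omega)
    refine ⟨(n + 1) * (m - n) * c, mul_ne_zero (mul_ne_zero (Nat.cast_add_one_ne_zero n) ?_) hc, ?_⟩
    · rw [sub_ne_zero, Ne, Nat.cast_inj]; omega
    · rw [pow_succ, Module.End.mul_apply, toEnd_apply_apply, P.lie_e_pow_succ_toEnd_f, map_smul, h,
        smul_smul]

/-- Nonzero vectors `eⁿ u` would be eigenvectors of `h` for the distinct eigenvalues `μ + 2n`, hence
infinitely many independent vectors. -/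
theorem exists_pow_toEnd_e_eq_zero [FiniteDimensional K U] (t : IsSl2Triple h e f) {u : U} {μ : K}
    (hu : ⁅h, u⁆ = μ • u) : ∃ n, (toEnd K L U e ^ n) u = 0 := by
  by_contra! hne
  have hinj : Function.Injective fun n : ℕ => μ + 2 * (n : K) := fun m n hmn => by
    simpa using hmn
  have hli := Module.End.eigenvectors_linearIndependent' (toEnd K L U h) _ hinj
    (fun n => (toEnd K L U e ^ n) u) fun n =>
      ⟨Module.End.mem_eigenspace_iff.2 (t.lie_h_pow_toEnd_e hu n), hne n⟩
  exact not_finite_iff_infinite.2 inferInstance hli.finite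

/-- Highest weight vectors lift along morphisms of representations of an `sl₂` triple. -/
theorem exists_lie_e_eq_zero (t : IsSl2Triple h e f) (b : U →ₗ⁅K,L⁆ W) (T : Submodule K U)
    (hTe : ∀ u ∈ T, ⁅e, u⁆ ∈ T) (hTf : ∀ u ∈ T, ⁅f, u⁆ ∈ T) {p : ℕ} {w : W} (hw : ⁅e, w⁆ = 0)
    (n : ℕ) {u : U} (hu : u ∈ T) (hhu : ⁅h, u⁆ = (p : K) • u)
    (hn : (toEnd K L U e ^ (n + 1)) u = 0) (hb : b u = w) :
    ∃ u' ∈ T, ⁅e, u'⁆ = 0 ∧ b u' = w := by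
  induction n generalizing u with
  | zero => exact ⟨u, hu, by simpa using hn, hb⟩
  | succ n ih =>
    set v := (toEnd K L U e ^ (n + 1)) u with hv
    by_cases hv0 : v = 0
    · exact ih hu hhu hv0 hb
    -- Here `v` is a highest weight vector of weight `p + 2(n + 1)`, so `e^(n+1) f^(n+1) v` is a
    -- nonzero multiple of `v`. Subtracting a multiple of `f^(n+1) v` from `u` lowers the power of
    -- `e` needed to kill it, and leaves the image under `b` unchanged because `b v = e^(n+1) w =
    -- 0`.
    have P : HasPrimitiveVectorWith t v ((p + 2 * (n + 1) : ℕ) : K) :=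
      ⟨hv0, by rw [t.lie_h_pow_toEnd_e hhu]; push_cast; rfl, by
        rw [← toEnd_apply_apply K, ← Module.End.mul_apply, ← pow_succ', hn]⟩
    obtain ⟨c, hc, hcv⟩ := P.pow_toEnd_e_pow_toEnd_f (n := n + 1) (by omega)
    have pow_mem : ∀ (x : L), (∀ u ∈ T, ⁅x, u⁆ ∈ T) → ∀ k, ∀ u ∈ T, (toEnd K L U x ^ k) u ∈ T := by
      intro x hx k
      induction k with
      | zero => intro u hu; simpa using hu
      | succ k ihk =>
        intro u hu
        rw [pow_succ', Module.End.mul_apply]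
        exact hx _ (ihk u hu)
    have b_pow : ∀ (x : L) k u, b ((toEnd K L U x ^ k) u) = (toEnd K L W x ^ k) (b u) := by
      intro x k
      induction k with
      | zero => intro u; simp
      | succ k ihk =>
        intro u
        rw [pow_succ, Module.End.mul_apply, ihk, pow_succ, Module.End.mul_apply, toEnd_apply_apply,
          toEnd_apply_apply, LieModuleHom.map_lie]
    refine ih (u := u - c⁻¹ • (toEnd K L U f ^ (n + 1)) v) ?_ ?_ ?_ ?_
    · exact T.sub_mem hu (T.smul_mem _ (pow_mem f hTf _ _ (pow_mem e hTe _ _ hu)))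
    · rw [lie_sub, lie_smul, P.lie_h_pow_toEnd_f, hhu, smul_sub]
      congr 1
      rw [smul_comm]
      congr 1
      push_cast
      ring
    · rw [map_sub, map_smul, hcv, smul_smul, inv_mul_cancel₀ hc, one_smul, hv, sub_self]
    · rw [map_sub, map_smul, b_pow, hv, b_pow, hb, pow_succ _ n,
        pow_succ (toEnd K L W e), Module.End.mul_apply (toEnd K L W e ^ n), toEnd_apply_apply K L W e,
        hw, map_zero, map_zero, smul_zero, sub_zero]

end IsSl2Triple

/-! ### Brackets of root vectors -/

namespace LieAlgebra.IsKilling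

open LieModule Module

variable {K L : Type*} [Field K] [CharZero K] [LieRing L] [LieAlgebra K L] [IsKilling K L]
  [FiniteDimensional K L] {H : LieSubalgebra K L} [H.IsCartanSubalgebra] [IsTriangularizable K H L]

theorem exists_smul_eq_of_mem_rootSpace {α : Weight K H L} (hα : α.IsNonZero) {x y : L}
    (hx : x ∈ rootSpace H α) (hx0 : x ≠ 0) (hy : y ∈ rootSpace H α) : ∃ c : K, c • x = y := by
  obtain ⟨c, hc⟩ := exists_smul_eq_of_finrank_eq_one (finrank_rootSpace_eq_one α hα)
    (x := (⟨x, hx⟩ : rootSpace H α)) (fun h => hx0 (congrArg Subtype.val h)) ⟨y, hy⟩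
  exact ⟨c, congrArg Subtype.val hc⟩

/-- The bracket of root vectors is nonzero if the sum of the roots is a weight. -/
theorem lie_ne_zero_of_mem_rootSpace {α β γ : Weight K H L} (hα : α.IsNonZero) (hβ : β.IsNonZero)
    (hγ : (γ : H → K) = α + β) {x y : L} (hx : x ∈ rootSpace H α) (hy : y ∈ rootSpace H β)
    (hx0 : x ≠ 0) (hy0 : y ≠ 0) : ⁅x, y⁆ ≠ 0 := by
  intro hxy
  obtain ⟨h, e, f, t, he, hf⟩ := exists_isSl2Triple_of_weight_isNonZero hα
  have hh := t.h_eq_coroot hα he hf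
  have lie_h : ∀ {χ : H → K} {v : L}, v ∈ rootSpace H χ → ⁅h, v⁆ = χ (coroot α) • v := by
    intro χ v hv
    rw [hh]
    exact lie_eq_smul_of_mem_rootSpace hv (coroot α)
  obtain ⟨c, rfl⟩ := exists_smul_eq_of_mem_rootSpace hα hx hx0 he
  have hey : ⁅c • x, y⁆ = 0 := by rw [smul_lie, hxy, smul_zero]
  have Py : t.HasPrimitiveVectorWith y (β (coroot α)) := ⟨hy0, lie_h hy, hey⟩
  -- If the bracket vanished, `y` would be a highest weight vector, of weight `n`. A vector of
  -- weight `n + 2` in the space of `γ` is raised to a highest weight vector `v` of weight `n + 2 +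
  -- 2k`. Then `f^(k+1) v` falls into the line of `y`, so `e` kills it, whereas `e f^(k+1) v` is a
  -- nonzero multiple of `f^k v ≠ 0`.
  obtain ⟨n, hn⟩ := Py.exists_nat
  obtain ⟨w, hw, hw0⟩ := γ.exists_ne_zero
  obtain ⟨k, hk, hk'⟩ := Nat.exists_not_and_succ_of_not_zero_of_exists
    (p := fun k => (toEnd K L L (c • x) ^ k) w = 0) (by simpa using hw0)
    (t.exists_pow_toEnd_e_eq_zero (lie_h hw))
  set v := (toEnd K L L (c • x) ^ k) w with hv
  have Pv : t.HasPrimitiveVectorWith v ((n + 2 + 2 * k : ℕ) : K) := by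
    refine ⟨hk, ?_, ?_⟩
    · rw [hv, t.lie_h_pow_toEnd_e (lie_h hw), hγ, Pi.add_apply, root_apply_coroot hα, hn]
      congr 1
      push_cast
      ring
    · rw [← toEnd_apply_apply K, ← Module.End.mul_apply, ← pow_succ', hk']
  have hv_mem : v ∈ rootSpace H (k • (α : H → K) + γ) := toEnd_pow_apply_mem he hw k
  have hfv : (toEnd K L L f ^ (k + 1)) v ∈ rootSpace H β := by
    have := toEnd_pow_apply_mem hf hv_mem (k + 1)
    convert! this using 2
    rw [hγ, succ_nsmul, smul_neg]
    abel
  obtain ⟨d, hd⟩ := exists_smul_eq_of_mem_rootSpace hβ hy hy0 hfv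
  have h1 := Pv.lie_e_pow_succ_toEnd_f k
  rw [← hd, lie_smul, hey, smul_zero, eq_comm, smul_eq_zero] at h1
  refine h1.elim (mul_ne_zero (Nat.cast_add_one_ne_zero k) ?_)
    (Pv.pow_toEnd_f_ne_zero_of_eq_nat rfl (by omega))
  rw [sub_ne_zero, Ne, Nat.cast_inj]
  omega

end LieAlgebra.IsKilling

/-! ### Sums of root spaces, and closed forms paired with simple root vectors -/

namespace LieAlgebra.IsKilling

open LieModule Module

variable {K L : Type*} [Field K] [CharZero K] [LieRing L] [LieAlgebra K L] [IsKilling K L]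
  [FiniteDimensional K L] {H : LieSubalgebra K L} [H.IsCartanSubalgebra] [IsTriangularizable K H L]

/-- The sum of the root spaces of a set of roots. -/
def rootSum (Φ : Set H.root) : LieSubmodule K H L :=
  ⨆ i ∈ Φ, rootSpace H (i : Weight K H L)

theorem mem_rootSum {Φ : Set H.root} {i : H.root} (hi : i ∈ Φ) {x : L}
    (hx : x ∈ rootSpace H (i : Weight K H L)) : x ∈ rootSum Φ :=
  (le_iSup₂_of_le (f := fun (i : H.root) (_ : i ∈ Φ) => rootSpace H (i : Weight K H L))
    i hi le_rfl : rootSpace H (i : Weight K H L) ≤ rootSum Φ) hx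

theorem rootSum_mono {Φ Ψ : Set H.root} (h : Φ ⊆ Ψ) : rootSum Φ ≤ rootSum Ψ :=
  iSup₂_le fun _ hi _ hx => mem_rootSum (h hi) hx

theorem rootSum_le {Φ : Set H.root} {S : Submodule K L}
    (h : ∀ i ∈ Φ, ∀ x ∈ rootSpace H (i : Weight K H L), x ∈ S) : (rootSum Φ).toSubmodule ≤ S := by
  rw [rootSum, LieSubmodule.iSup_toSubmodule]
  refine iSup_le fun i => ?_
  rw [LieSubmodule.iSup_toSubmodule]
  exact iSup_le fun hi => h i hi

theorem lie_mem_rootSum {Φ Ψ : Set H.root} {χ : H → K}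
    (h : ∀ i ∈ Φ, rootSpace H (χ + (i : Weight K H L)) ≠ ⊥ →
      ∃ j ∈ Ψ, ((j : Weight K H L) : H → K) = χ + (i : Weight K H L))
    {x y : L} (hx : x ∈ rootSpace H χ) (hy : y ∈ rootSum Φ) : ⁅x, y⁆ ∈ rootSum Ψ := by
  refine rootSum_le (S := (rootSum Ψ).toSubmodule.comap (ad K L x)) (fun i hi y hy => ?_) hy
  have hxy := lie_mem_genWeightSpace_of_mem_genWeightSpace hx hy
  by_cases hbot : rootSpace H (χ + (i : Weight K H L)) = ⊥
  · change ⁅x, y⁆ ∈ rootSum Ψ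
    rw [(LieSubmodule.mem_bot _).1 (hbot.le hxy)]
    exact zero_mem _
  · obtain ⟨j, hj, hij⟩ := h i hi hbot
    rw [← hij] at hxy
    exact mem_rootSum hj hxy

theorem exists_eq_of_mem_rootSum {Φ : Set H.root} {χ : Weight K H L} {x : L}
    (hx : x ∈ rootSpace H χ) (hx' : x ∈ rootSum Φ) (hx0 : x ≠ 0) : ∃ i ∈ Φ, (i : Weight K H L) = χ := by
  by_contra! hne
  have hle : rootSum Φ ≤ ⨆ (ψ : Weight K H L) (_ : ψ ≠ χ), rootSpace H ψ :=
    iSup₂_le fun i hi => le_iSup₂_of_le (i : Weight K H L) (hne i hi) le_rfl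
  have := (iSupIndep_genWeightSpace' K H L χ).le_bot ⟨hx, hle hx'⟩
  exact hx0 (by simpa using this)

theorem exists_root_eq {χ : H → K} (h0 : χ ≠ 0) (h : rootSpace H χ ≠ ⊥) :
    ∃ i : H.root, ((i : Weight K H L) : H → K) = χ :=
  ⟨⟨⟨χ, h⟩, Finset.mem_filter.2 ⟨Finset.mem_univ _, h0⟩⟩, rfl⟩

theorem root_eq_add_iff {i j k : H.root} :
    (rootSystem H).root i = (rootSystem H).root j + (rootSystem H).root k ↔
      ((i : Weight K H L) : H → K) = (j : Weight K H L) + (k : Weight K H L) := by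
  simp only [rootSystem_root_apply, LinearMap.ext_iff, funext_iff]
  rfl

theorem root_eq_sub_iff {i j k : H.root} :
    (rootSystem H).root i = (rootSystem H).root j - (rootSystem H).root k ↔
      ((i : Weight K H L) : H → K) = (j : Weight K H L) - (k : Weight K H L) := by
  simp only [rootSystem_root_apply, LinearMap.ext_iff, funext_iff]
  rfl

theorem exists_isPos_eq_add {b : (rootSystem H).Base} {i j : H.root} (hi : b.IsPos i)
    (hj : b.IsPos j) (h : rootSpace H ((i : Weight K H L) + (j : Weight K H L) : H → K) ≠ ⊥) :
    ∃ k, b.IsPos k ∧ ((k : Weight K H L) : H → K) = (i : Weight K H L) + (j : Weight K H L) := by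
  have h0 : ((i : Weight K H L) + (j : Weight K H L) : H → K) ≠ 0 := by
    intro h0
    have h1 : (rootSystem H).root i = -(rootSystem H).root j := by
      rw [eq_neg_iff_add_eq_zero]
      simp only [rootSystem_root_apply, LinearMap.ext_iff]
      exact congrFun h0
    have h2 : i = (rootSystem H).reflectionPerm j j := by
      apply (rootSystem H).root.injective
      rw [RootPairing.root_reflectionPerm, RootPairing.reflection_apply_self, h1]
    have h3 : b.height ((rootSystem H).reflectionPerm j j) = -b.height j :=
      b.height_reflectionPerm_self j
    rw [RootPairing.Base.isPos_iff] at hi hj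
    rw [← h2] at h3
    omega
  obtain ⟨k, hk⟩ := exists_root_eq h0 h
  exact ⟨k, hi.add hj (root_eq_add_iff.2 hk), hk⟩

/-- A closed two-form pairs a central root vector trivially with a simple root vector `e`, provided
the root space of the central vector is the bracket of two positive root spaces different from
that of `e`. -/
theorem apply_eq_zero_of_mem_support {b : (rootSystem H).Base} {a i j k : H.root}
    (ha : a ∈ b.support) (hj : b.IsPos j) (hk : b.IsPos k) (hja : j ≠ a) (hka : k ≠ a)
    (hijk : ((i : Weight K H L) : H → K) = (j : Weight K H L) + (k : Weight K H L))
    {Ω : L →ₗ[K] L →ₗ[K] K} (hΩ : ∀ x ∈ rootSum {j | b.IsPos j}, Ω x x = 0)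
    (hΩ' : ∀ x ∈ rootSum {j | b.IsPos j}, ∀ y ∈ rootSum {j | b.IsPos j},
      ∀ z ∈ rootSum {j | b.IsPos j}, Ω ⁅x, y⁆ z - Ω ⁅x, z⁆ y + Ω ⁅y, z⁆ x = 0)
    {z : L} (hz : z ∈ rootSpace H (i : Weight K H L)) {e' : L}
    (he' : e' ∈ rootSpace H (a : Weight K H L)) (hez : ⁅e', z⁆ = 0) : Ω z e' = 0 := by
  have ha0 : (a : Weight K H L).IsNonZero := H.isNonZero_coe_root a
  by_cases he0 : e' = 0
  · rw [he0, map_zero]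
  by_cases hz0 : z = 0
  · rw [hz0, map_zero, LinearMap.zero_apply]
  obtain ⟨h, e, f, t, he, hf⟩ := exists_isSl2Triple_of_weight_isNonZero ha0
  obtain ⟨c, hc⟩ := exists_smul_eq_of_mem_rootSpace ha0 he t.e_ne_zero he'
  obtain ⟨c', hc'⟩ := exists_smul_eq_of_mem_rootSpace ha0 he' he0 he
  replace hez : ⁅e, z⁆ = 0 := by rw [← hc', smul_lie, hez, smul_zero]
  suffices hsuff : Ω z e = 0 by rw [← hc, map_smul, hsuff, smul_zero]
  have hh := t.h_eq_coroot ha0 he hf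
  have lie_h : ∀ {χ : H → K} {v : L}, v ∈ rootSpace H χ →
      ⁅h, v⁆ = χ (coroot (a : Weight K H L)) • v := by
    intro χ v hv
    rw [hh]
    exact lie_eq_smul_of_mem_rootSpace hv _
  set N := rootSum {j | b.IsPos j} with hN
  -- `P` is stable under `e` and `f`: adding `a` to a positive root cannot give `a`. Subtracting `a`
  -- from a positive root other than `a` leaves, if anything, a positive root, which is not `a`
  -- since `2a` is not a root.
  set P := rootSum {j | b.IsPos j ∧ j ≠ a} with hP
  have hPN : P ≤ N := rootSum_mono fun _ h => h.1
  have heP : ∀ x ∈ P, ⁅e, x⁆ ∈ P := fun x hx => by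
    refine lie_mem_rootSum (fun l hl hne => ?_) he hx
    obtain ⟨m, hm, hm'⟩ := exists_isPos_eq_add (RootPairing.Base.isPos_of_mem_support ha) hl.1 hne
    refine ⟨m, ⟨hm, ?_⟩, hm'⟩
    rintro rfl
    exact H.isNonZero_coe_root l (by simp at hm')
  have hfP : ∀ x ∈ P, ⁅f, x⁆ ∈ P := fun x hx => by
    refine lie_mem_rootSum (fun l hl hne => ?_) hf hx
    have h0 : (-(a : Weight K H L) + (l : Weight K H L) : H → K) ≠ 0 := by
      intro h0
      rw [neg_add_eq_zero] at h0
      exact hl.2 (Subtype.ext (Weight.ext fun x => (congrFun h0 x).symm))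
    obtain ⟨m, hm⟩ := exists_root_eq h0 hne
    have hm' := hm
    rw [neg_add_eq_sub] at hm'
    have hpos := hl.1.sub ha (root_eq_sub_iff.2 hm')
    refine ⟨m, ⟨hpos, ?_⟩, hm⟩
    rintro rfl
    have hadd : (rootSystem H).root l = 2 • (rootSystem H).root m := by
      rw [two_smul, root_eq_add_iff, ← sub_eq_iff_eq_add, ← hm']
    have : IsAddTorsionFree (Dual K H) := .of_isTorsionFree K _
    exact (rootSystem H).nsmul_notMem_range_root (n := 2) ⟨l, hadd⟩
  let T : Submodule K (L ⊗[K] L) := Submodule.map₂ (TensorProduct.mk K L L) P P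
  have T_lie : ∀ g : L, (∀ x ∈ P, ⁅g, x⁆ ∈ P) → ∀ u ∈ T, ⁅g, u⁆ ∈ T := by
    intro g hg
    have : T ≤ T.comap (toEnd K L (L ⊗[K] L) g) := by
      refine Submodule.map₂_le.2 fun x hx y hy => ?_
      change ⁅g, x ⊗ₜ[K] y⁆ ∈ T
      rw [TensorProduct.LieModule.lie_tmul_right]
      exact T.add_mem (Submodule.apply_mem_map₂ _ (hg x hx) hy)
        (Submodule.apply_mem_map₂ _ hx (hg y hy))
    exact this
  obtain ⟨x, hx, hx0⟩ := (j : Weight K H L).exists_ne_zero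
  obtain ⟨y, hy, hy0⟩ := (k : Weight K H L).exists_ne_zero
  have hxy := lie_ne_zero_of_mem_rootSpace (H.isNonZero_coe_root j) (H.isNonZero_coe_root k) hijk
    hx hy hx0 hy0
  have hxy' : ⁅x, y⁆ ∈ rootSpace H (i : Weight K H L) := by
    rw [hijk]
    exact lie_mem_genWeightSpace_of_mem_genWeightSpace hx hy
  obtain ⟨d, hd⟩ := exists_smul_eq_of_mem_rootSpace (H.isNonZero_coe_root i) hxy' hxy hz
  have Pz : t.HasPrimitiveVectorWith z _ := ⟨hz0, lie_h hz, hez⟩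
  obtain ⟨p, hp⟩ := Pz.exists_nat
  have hxyT : d • (x ⊗ₜ[K] y) ∈ T := T.smul_mem _
    (Submodule.apply_mem_map₂ _ (mem_rootSum (Φ := {j | b.IsPos j ∧ j ≠ a}) ⟨hj, hja⟩ hx)
      (mem_rootSum (Φ := {j | b.IsPos j ∧ j ≠ a}) ⟨hk, hka⟩ hy))
  have hhu : ⁅h, d • (x ⊗ₜ[K] y)⁆ = (p : K) • (d • x ⊗ₜ[K] y) := by
    rw [lie_smul, TensorProduct.LieModule.lie_tmul_right, lie_h hx, lie_h hy, ← hp, hijk,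
      Pi.add_apply, ← TensorProduct.smul_tmul', TensorProduct.tmul_smul, ← add_smul, smul_comm]
  obtain ⟨n, hn⟩ := t.exists_pow_toEnd_e_eq_zero hhu
  -- The tensor `d • (x ⊗ y)` has bracket `z` and the same `h`-weight `p`; here it is replaced by a
  -- tensor in `T` that `e` also kills.
  obtain ⟨u, huT, heu, hbu⟩ := t.exists_lie_e_eq_zero (toModuleHom K L L) T (T_lie e heP)
    (T_lie f hfP) hez n hxyT hhu (by rw [pow_succ', Module.End.mul_apply, hn, map_zero])
    (by rw [map_smul, toModuleHom_apply, hd])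
  have heN : e ∈ N := mem_rootSum (RootPairing.Base.isPos_of_mem_support ha) he
  have skew : ∀ x ∈ N, ∀ y ∈ N, Ω x y = -Ω y x := by
    intro x hx y hy
    have := hΩ (x + y) (N.add_mem hx hy)
    simp only [map_add, LinearMap.add_apply, hΩ x hx, hΩ y hy, zero_add, add_zero] at this
    exact eq_neg_of_add_eq_zero_right this
  -- Closedness on triples `(x, y, e)` as a linear identity on `T`: `Ω([u], e) + Ω(e · u) = 0`.
  have key : T ≤ LinearMap.ker ((Ω.flip e) ∘ₗ (toModuleHom K L L : L ⊗[K] L →ₗ[K] L) +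
      (TensorProduct.lift Ω) ∘ₗ (toEnd K L (L ⊗[K] L) e)) := by
    refine Submodule.map₂_le.2 fun x hx y hy => ?_
    rw [LinearMap.mem_ker]
    change Ω (toModuleHom K L L (x ⊗ₜ[K] y)) e + TensorProduct.lift Ω ⁅e, x ⊗ₜ[K] y⁆ = 0
    rw [TensorProduct.LieModule.lie_tmul_right, toModuleHom_apply, map_add, TensorProduct.lift.tmul,
      TensorProduct.lift.tmul, skew x (hPN hx) _ (hPN (heP y hy)), ← lie_skew e x, ← lie_skew e y]
    have := hΩ' x (hPN hx) y (hPN hy) e heN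
    simp only [map_neg, LinearMap.neg_apply, neg_neg]
    linear_combination this
  have := key huT
  rw [LinearMap.mem_ker] at this
  change Ω (toModuleHom K L L u) e + TensorProduct.lift Ω ⁅e, u⁆ = 0 at this
  rwa [heu, map_zero, add_zero, hbu] at this

end LieAlgebra.IsKilling

theorem Submodule.finrank_biSup_le {K V ι : Type*} [Field K] [AddCommGroup V] [Module K V]
    [FiniteDimensional K V] (s : Finset ι) (W : ι → Submodule K V)
    (h : ∀ i ∈ s, Module.finrank K (W i) ≤ 1) :
    Module.finrank K (⨆ i ∈ s, W i : Submodule K V) ≤ s.card := by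
  classical
  induction s using Finset.induction_on with
  | empty => simp
  | insert i s hi ih =>
    rw [Finset.iSup_insert, Finset.card_insert_of_notMem hi, add_comm]
    exact (Submodule.finrank_add_le_finrank_add_finrank _ _).trans
      (add_le_add (h i (Finset.mem_insert_self i s))
        (ih fun j hj => h j (Finset.mem_insert_of_mem hj)))

/-! ### The rank bound, central elements and the lower central series -/

namespace LieAlgebra.IsKilling

open LieModule Module

variable {K L : Type*} [Field K] [CharZero K] [LieRing L] [LieAlgebra K L] [IsKilling K L]
  [FiniteDimensional K L] {H : LieSubalgebra K L} [H.IsCartanSubalgebra] [IsTriangularizable K H L]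

theorem finrank_le_add_card_root :
    finrank K L ≤ finrank K H + Nat.card H.root := by
  have h := congrArg LieSubmodule.toSubmodule (cartan_sup_iSup_rootSpace_eq_top (K := K) H)
  rw [LieSubmodule.sup_toSubmodule, LieSubmodule.top_toSubmodule, LieSubmodule.iSup_toSubmodule]
    at h
  simp only [LieSubmodule.iSup_toSubmodule] at h
  have h1 := Submodule.finrank_biSup_le H.root
    (fun α : Weight K H L => (rootSpace H α).toSubmodule) fun α hα =>
      (finrank_rootSpace_eq_one α (by simpa using hα)).le
  have h2 := Submodule.finrank_add_le_finrank_add_finrank H.toLieSubmodule.toSubmodule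
    (⨆ α ∈ H.root, (rootSpace H (α : Weight K H L)).toSubmodule)
  have hmem : ∀ α : Weight K H L, α ∈ H.root ↔ α.IsNonZero := fun α => by simp
  have heq : (⨆ α ∈ H.root, (rootSpace H (α : Weight K H L)).toSubmodule) =
      ⨆ (α : Weight K H L) (_ : α.IsNonZero), (rootSpace H α).toSubmodule := by
    simp only [hmem]
  rw [heq, h, finrank_top] at h2
  rw [heq] at h1
  rw [Nat.card_eq_fintype_card, Fintype.card_coe]
  exact h2.trans (Nat.add_le_add_left h1 _)

/-- In rank at most two the dimension is at most `2 + 12 = 14`. -/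
theorem three_le_card_support [(rootSystem H).IsIrreducible] (b : (rootSystem H).Base)
    (h : 15 ≤ finrank K L) : 3 ≤ b.support.card := by
  by_contra! hb
  have h1 := RootPairing.Base.card_le_twelve (b := b) (by omega)
  have h2 : finrank K H = b.support.card := by
    rw [← Subspace.dual_finrank_eq, finrank_eq_card_basis b.toWeightBasis, Fintype.card_coe]
  have h3 := finrank_le_add_card_root (K := K) (H := H)
  omega

/-- A closed two-form on the sum of the positive root spaces pairs trivially with the central
elements. -/
theorem apply_eq_zero_of_central [(rootSystem H).IsIrreducible] {b : (rootSystem H).Base}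
    (hb : 3 ≤ b.support.card)
    {Ω : L →ₗ[K] L →ₗ[K] K} (hΩ : ∀ x ∈ rootSum {j | b.IsPos j}, Ω x x = 0)
    (hΩ' : ∀ x ∈ rootSum {j | b.IsPos j}, ∀ y ∈ rootSum {j | b.IsPos j},
      ∀ z ∈ rootSum {j | b.IsPos j}, Ω ⁅x, y⁆ z - Ω ⁅x, z⁆ y + Ω ⁅y, z⁆ x = 0)
    {z : L} (hz : z ∈ rootSum {j | b.IsPos j}) (hz' : ∀ x ∈ rootSum {j | b.IsPos j}, ⁅x, z⁆ = 0)
    {x : L} (hx : x ∈ rootSum {j | b.IsPos j}) : Ω z x = 0 := by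
  set N := rootSum {j | b.IsPos j} with hN
  have skew : ∀ x ∈ N, ∀ y ∈ N, Ω x y = -Ω y x := by
    intro x hx y hy
    have := hΩ (x + y) (N.add_mem hx hy)
    simp only [map_add, LinearMap.add_apply, hΩ x hx, hΩ y hy, zero_add, add_zero] at this
    exact eq_neg_of_add_eq_zero_right this
  -- The center of `N` is stable under `H`, hence the sum of its weight components; this reduces the
  -- claim to a central root vector.
  let Z : LieSubmodule K H L :=
    { carrier := {z | z ∈ N ∧ ∀ x ∈ N, ⁅x, z⁆ = 0}
      zero_mem' := ⟨N.zero_mem, fun x _ => lie_zero x⟩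
      add_mem' := fun {z w} hz hw => ⟨N.add_mem hz.1 hw.1, fun x hx => by
        rw [lie_add, hz.2 x hx, hw.2 x hx, add_zero]⟩
      smul_mem' := fun c z hz => ⟨N.smul_mem c hz.1, fun x hx => by
        rw [lie_smul, hz.2 x hx, smul_zero]⟩
      lie_mem := fun {h z} hz => ⟨N.lie_mem hz.1, fun x hx => by
        have hxh : ⁅x, (h : L)⁆ ∈ N := by
          rw [← lie_skew]
          exact neg_mem (N.lie_mem (x := h) hx)
        rw [LieSubalgebra.coe_bracket_of_module, leibniz_lie, hz.2 x hx, lie_zero, add_zero,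
          hz.2 _ hxh]⟩ }
  have hle : Z.toSubmodule ≤ LinearMap.ker (Ω.flip x) := by
    have hZ : Z = ⨆ χ : Weight K H L, Z ⊓ genWeightSpace L χ :=
      eq_iSup_inf_genWeightSpace (N := Z)
    rw [hZ, LieSubmodule.iSup_toSubmodule]
    refine iSup_le fun χ z hz => ?_
    obtain ⟨⟨hzN, hzZ⟩, hzχ⟩ : (z ∈ N ∧ ∀ x ∈ N, ⁅x, z⁆ = 0) ∧ z ∈ genWeightSpace L χ := hz
    rw [LinearMap.mem_ker, LinearMap.flip_apply]
    by_cases hz0 : z = 0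
    · rw [hz0, map_zero, LinearMap.zero_apply]
    obtain ⟨i, hi, rfl⟩ := exists_eq_of_mem_rootSum hzχ hzN hz0
    -- If `i + a` were a root, the bracket of a root vector of `a` with `z` would be nonzero,
    -- contradicting centrality.
    have hmax : ∀ a ∈ b.support,
        (rootSystem H).root i + (rootSystem H).root a ∉ Set.range (rootSystem H).root := by
      rintro a ha ⟨k, hk⟩
      obtain ⟨e, he, he0⟩ := (a : Weight K H L).exists_ne_zero
      rw [add_comm, root_eq_add_iff] at hk
      exact lie_ne_zero_of_mem_rootSpace (H.isNonZero_coe_root a) (H.isNonZero_coe_root i) hk he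
        hzχ he0 hz0 (hzZ e (mem_rootSum (RootPairing.Base.isPos_of_mem_support ha) he))
    have hle : N.toSubmodule ≤ LinearMap.ker (Ω z) := by
      refine rootSum_le fun l hl y hy => ?_
      rw [LinearMap.mem_ker]
      by_cases hls : l ∈ b.support
      · obtain ⟨j, k, hj, hk, hja, hka, hijk⟩ :=
          RootPairing.Base.exists_add_of_maximal hb hi hmax hls
        exact apply_eq_zero_of_mem_support hls hj hk hja hka (root_eq_add_iff.1 hijk) hΩ hΩ' hzχ hy
          (hzZ y (mem_rootSum hl hy))
      · obtain ⟨a, ha, hal⟩ := RootPairing.Base.IsPos.exists_mem_support_pos_pairingIn hl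
        rw [(rootSystem H).zero_lt_pairingIn_iff'] at hal
        obtain ⟨m, hm⟩ := (rootSystem H).root_sub_root_mem_of_pairingIn_pos hal
          (fun h => hls (h ▸ ha))
        have hmpos : b.IsPos m := RootPairing.Base.IsPos.sub hl ha hm
        -- A nonsimple positive root is a simple root plus a positive root, so its root vector is a
        -- multiple of a bracket `⁅u, v⁆`. Closedness on `(u, v, z)` with `z` central then gives the
        -- vanishing.
        have hlam : ((l : Weight K H L) : H → K) = (a : Weight K H L) + (m : Weight K H L) := by
          rw [← root_eq_add_iff, hm, add_sub_cancel]
        obtain ⟨u, hu, hu0⟩ := (a : Weight K H L).exists_ne_zero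
        obtain ⟨v, hv, hv0⟩ := (m : Weight K H L).exists_ne_zero
        have huv := lie_ne_zero_of_mem_rootSpace (H.isNonZero_coe_root a) (H.isNonZero_coe_root m)
          hlam hu hv hu0 hv0
        have huv' : ⁅u, v⁆ ∈ rootSpace H (l : Weight K H L) := by
          rw [hlam]
          exact lie_mem_genWeightSpace_of_mem_genWeightSpace hu hv
        obtain ⟨c, rfl⟩ := exists_smul_eq_of_mem_rootSpace (H.isNonZero_coe_root l) huv' huv hy
        have huN : u ∈ N := mem_rootSum (RootPairing.Base.isPos_of_mem_support ha) hu
        have hvN : v ∈ N := mem_rootSum hmpos hv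
        have := hΩ' u huN v hvN z hzN
        rw [hzZ u huN, hzZ v hvN, map_zero, LinearMap.zero_apply, LinearMap.zero_apply, sub_zero,
          add_zero] at this
        rw [map_smul, skew z hzN _ (mem_rootSum hl huv'), this, neg_zero, smul_zero]
    exact hle hx
  exact hle ⟨hz, hz'⟩

variable {b : (rootSystem H).Base} {N : LieSubalgebra K L}

/-- Each bracket with a positive root vector raises the height by at least one. The numbering starts
at zero, where all heights are positive; bounded height then gives nilpotency. -/
theorem lowerCentralSeries_le_rootSum (hN : N.toSubmodule = (rootSum {j | b.IsPos j}).toSubmodule)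
    (k : ℕ) : ∀ z ∈ lowerCentralSeries K N N k, (z : L) ∈ rootSum {j | (k : ℤ) < b.height j} := by
  have memN : ∀ {x : L}, x ∈ N ↔ x ∈ rootSum {j | b.IsPos j} := by
    intro x
    rw [← LieSubalgebra.mem_toSubmodule, hN, LieSubmodule.mem_toSubmodule]
  induction k with
  | zero => exact fun z _ => memN.1 z.2
  | succ k ih =>
    intro z hz
    rw [lowerCentralSeries_succ, ← LieSubmodule.mem_toSubmodule,
      LieSubmodule.lieIdeal_oper_eq_linear_span'] at hz
    refine (Submodule.span_le.2 ?_ : _ ≤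
      (rootSum {j | ((k + 1 : ℕ) : ℤ) < b.height j}).toSubmodule.comap N.subtype) hz
    rintro _ ⟨x, -, y, hy, rfl⟩
    change ⁅(x : L), (y : L)⁆ ∈ rootSum {j | ((k + 1 : ℕ) : ℤ) < b.height j}
    rw [← lie_skew, neg_mem_iff]
    refine rootSum_le (S := (rootSum {j | ((k + 1 : ℕ) : ℤ) < b.height j}).toSubmodule.comap
      (ad K L (y : L))) (fun i hi x hx => ?_) (memN.1 x.2)
    change ⁅(y : L), x⁆ ∈ rootSum {j | ((k + 1 : ℕ) : ℤ) < b.height j}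
    rw [← lie_skew, neg_mem_iff]
    refine lie_mem_rootSum (fun j hj hne => ?_) hx (ih y hy)
    have hj' : (k : ℤ) < b.height j := hj
    obtain ⟨m, -, hm⟩ := exists_isPos_eq_add hi (b.isPos_iff.2 (by omega)) hne
    refine ⟨m, ?_, hm⟩
    have hi' : 0 < b.height i := hi
    rw [Set.mem_ofPred_eq, b.height_add (root_eq_add_iff.2 hm)]
    push_cast
    omega

theorem isNilpotent_of_toSubmodule_eq
    (hN : N.toSubmodule = (rootSum {j | b.IsPos j}).toSubmodule) : LieRing.IsNilpotent N := by
  obtain ⟨m, hm⟩ := (Set.finite_range b.height).bddAbove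
  have : LieModule.IsNilpotent N N := by
    refine (LieModule.isNilpotent_iff K N N).2 ⟨m.toNat, ?_⟩
    rw [eq_bot_iff]
    intro z hz
    have := lowerCentralSeries_le_rootSum hN _ z hz
    have hempty : {j | (m.toNat : ℤ) < b.height j} = ∅ := by
      refine Set.eq_empty_of_forall_notMem fun j hj => ?_
      have := hm ⟨j, rfl⟩
      rw [Set.mem_ofPred_eq] at hj
      omega
    rw [hempty, rootSum] at this
    simpa using this
  exact this

theorem apply_eq_zero_of_mem_lowerCentralSeries [(rootSystem H).IsIrreducible]
    (hb : 3 ≤ b.support.card) (hN : N.toSubmodule = (rootSum {j | b.IsPos j}).toSubmodule)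
    {ω : N →ₗ[K] N →ₗ[K] K} (hω : ∀ x, ω x x = 0)
    (hω' : ∀ x y z, ω ⁅x, y⁆ z - ω ⁅x, z⁆ y + ω ⁅y, z⁆ x = 0) {z : N}
    (hz : z ∈ lowerCentralSeries K N N (nilpotencyLength N N - 1)) (x : N) : ω z x = 0 := by
  have memN : ∀ {x : L}, x ∈ rootSum {j | b.IsPos j} ↔ x ∈ N := by
    intro x
    rw [← LieSubalgebra.mem_toSubmodule, hN, LieSubmodule.mem_toSubmodule]
  -- A linear retraction onto `N` extends `ω` to a bilinear form on `L`. It need not be closed or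
  -- respect brackets off `N`.
  obtain ⟨π, hπ⟩ := N.toSubmodule.subtype.exists_leftInverse_of_injective
    (LinearMap.ker_eq_bot.2 Subtype.val_injective)
  replace hπ : ∀ y : N, π y = y := fun y => LinearMap.congr_fun hπ y
  have hnil : LieModule.IsNilpotent N N := isNilpotent_of_toSubmodule_eq hN
  -- Makes the last nonzero term central. Truncated subtraction also allows length zero, where `N`
  -- is trivial.
  have hbot : lowerCentralSeries K N N (nilpotencyLength N N - 1 + 1) = ⊥ := by
    rw [eq_bot_iff]
    refine (antitone_lowerCentralSeries K N N (show nilpotencyLength N N ≤ _ by omega)).trans ?_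
    rcases hk : nilpotencyLength N N with _ | k
    · have := (nilpotencyLength_eq_zero_iff N N).1 hk
      exact fun y _ => by simp [Subsingleton.elim y 0]
    · exact (((nilpotencyLength_eq_succ_iff K N N k).1 hk).1).le
  have hcent : ∀ y : N, ⁅y, z⁆ = 0 := fun y => by
    rw [← LieSubmodule.mem_bot (R := K) (L := N), ← hbot, lowerCentralSeries_succ]
    exact LieSubmodule.lie_mem_lie (LieSubmodule.mem_top y) hz
  have main := apply_eq_zero_of_central hb (Ω := ω.compl₁₂ π π)
    (fun y hy => hω _) (fun u hu v hv w hw => by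
      have h : ∀ u v : N, π ⁅(u : L), (v : L)⁆ = ⁅u, v⁆ := fun u v => hπ ⁅u, v⁆
      lift u to N using memN.1 hu
      lift v to N using memN.1 hv
      lift w to N using memN.1 hw
      simp only [LinearMap.compl₁₂_apply, h, hπ]
      exact hω' u v w) (memN.2 z.2)
    (fun y hy => congrArg Subtype.val (hcent ⟨y, memN.1 hy⟩)) (memN.2 x.2)
  simpa [LinearMap.compl₁₂_apply, hπ] using main

end LieAlgebra.IsKilling

/-! ### From systems of simple roots to bases of the root system -/

namespace SplitLie

open LieAlgebra LieAlgebra.IsKilling LieModule Module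

variable {𝔤 : Type*} [LieRing 𝔤] [LieAlgebra ℝ 𝔤] [LieAlgebra.IsKilling ℝ 𝔤]
  [FiniteDimensional ℝ 𝔤] {H : LieSubalgebra ℝ 𝔤} [H.IsCartanSubalgebra]
  [LieModule.IsTriangularizable ℝ H 𝔤]

theorem mem_roots_iff {α : Dual ℝ H} : α ∈ roots H ↔ α ∈ Set.range (rootSystem H).root := by
  constructor
  · rintro ⟨h0, h⟩
    obtain ⟨i, hi⟩ := exists_root_eq (χ := α) (fun h => h0 (DFunLike.coe_injective h)) h
    exact ⟨i, DFunLike.coe_injective hi⟩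
  · rintro ⟨i, rfl⟩
    exact ⟨(rootSystem H).ne_zero i, (i : Weight ℝ H 𝔤).genWeightSpace_ne_bot⟩

namespace SimpleSystem

variable (S : SimpleSystem H)

theorem image_root_setOf_mem_simple :
    (rootSystem H).root '' {i | (rootSystem H).root i ∈ S.simple} = S.simple := by
  ext α
  constructor
  · rintro ⟨i, hi, rfl⟩
    exact hi
  · intro hα
    obtain ⟨i, rfl⟩ := mem_roots_iff.1 (S.subset_roots hα)
    exact ⟨i, hα, rfl⟩

theorem linearIndepOn_root :
    LinearIndepOn ℝ (rootSystem H).root {i | (rootSystem H).root i ∈ S.simple} := by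
  rw [linearIndepOn_iff_image (rootSystem H).root.injective.injOn,
    S.image_root_setOf_mem_simple]
  exact S.linearIndep

/-- The base of the root system given by a system of simple roots. -/
noncomputable def base : (rootSystem H).Base :=
  RootPairing.Base.mk' (rootSystem H) {i | (rootSystem H).root i ∈ S.simple} S.linearIndepOn_root
    fun i => by
      rw [S.image_root_setOf_mem_simple]
      exact S.pos_or_neg _ (mem_roots_iff.2 ⟨i, rfl⟩)

theorem mem_base_support {i : H.root} :
    i ∈ S.base.support ↔ (rootSystem H).root i ∈ S.simple := by
  change i ∈ (Set.toFinite _).toFinset ↔ _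
  rw [Set.Finite.mem_toFinset]
  rfl

/-- A functional equal to 1 on the simple roots computes the height, and it is nonnegative on their
additive closure; its sign decides between a root and its negative. -/
theorem isPos_base_iff {i : H.root} :
    S.base.IsPos i ↔ (rootSystem H).root i ∈ AddSubmonoid.closure S.simple := by
  obtain ⟨φ, hφ⟩ := exists_dual_forall_apply_eq_one S.linearIndepOn_root
  have hnonneg : ∀ α ∈ AddSubmonoid.closure S.simple, 0 ≤ φ α := by
    intro α hα
    induction hα using AddSubmonoid.closure_induction with
    | mem α hα =>
      obtain ⟨i, hi, rfl⟩ := S.image_root_setOf_mem_simple.symm.le hα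
      rw [hφ i hi]
      exact zero_le_one
    | zero => rw [map_zero]
    | add α β _ _ hα hβ => rw [map_add]; exact add_nonneg hα hβ
  have hheight : φ ((rootSystem H).root i) = S.base.height i := by
    obtain ⟨f, -, -, hf⟩ := S.base.exists_root_eq_sum_int i
    rw [S.base.height_eq_sum hf, hf, map_sum, Int.cast_sum]
    refine Finset.sum_congr rfl fun j hj => ?_
    rw [map_zsmul, hφ j (S.mem_base_support.1 hj), zsmul_eq_mul, mul_one]
  constructor
  · intro hi
    refine (S.pos_or_neg _ (mem_roots_iff.2 ⟨i, rfl⟩)).resolve_right fun hneg => ?_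
    have := hnonneg _ hneg
    rw [map_neg, hheight, neg_nonneg] at this
    exact absurd (Int.cast_pos.2 hi : (0 : ℝ) < S.base.height i) this.not_gt
  · intro hi
    rw [RootPairing.Base.isPos_iff']
    have := hnonneg _ hi
    rw [hheight] at this
    exact Int.cast_nonneg_iff.1 this

theorem nilradical_toSubmodule :
    S.nilradical.toSubmodule = (rootSum {j | S.base.IsPos j}).toSubmodule := by
  apply le_antisymm
  · refine iSup₂_le fun α hα x hx => ?_
    obtain ⟨i, rfl⟩ := mem_roots_iff.1 hα.1
    exact mem_rootSum (Φ := {j | S.base.IsPos j}) (S.isPos_base_iff.2 hα.2) hx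
  · refine rootSum_le fun i hi x hx => ?_
    exact Submodule.mem_iSup_of_mem ((rootSystem H).root i) (Submodule.mem_iSup_of_mem
      ⟨mem_roots_iff.2 ⟨i, rfl⟩, S.isPos_base_iff.1 hi⟩ hx)

end SimpleSystem

end SplitLie

/-- `𝔤` is a real Lie algebra with a splitting Cartan subalgebra `H` (so `𝔤` is the split real form
of its complexification), `S` is a system of simple roots, and `S.nilradical` is the nilradical of
the corresponding minimal parabolic subalgebra. -/
theorem lemma4p1 {𝔤 : Type*} [LieRing 𝔤] [LieAlgebra ℝ 𝔤]
    (H : LieSubalgebra ℝ 𝔤) [H.IsCartanSubalgebra] [LieModule.IsTriangularizable ℝ H 𝔤]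
    (S : SplitLie.SimpleSystem H) (n : ℕ)
    (h𝔤 : (3 ≤ n ∧ SplitLie.IsRealForm 𝔤 (LieAlgebra.SpecialLinear.sl (Fin (n + 1)) ℂ)) ∨
      (3 ≤ n ∧ SplitLie.IsRealForm 𝔤 (LieAlgebra.Orthogonal.so (Fin (2 * n + 1)) ℂ)) ∨
      (3 ≤ n ∧ SplitLie.IsRealForm 𝔤 (LieAlgebra.Symplectic.sp (Fin n) ℂ)) ∨
      (4 ≤ n ∧ SplitLie.IsRealForm 𝔤 (LieAlgebra.Orthogonal.so (Fin (2 * n)) ℂ))) :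
    LieRing.IsNilpotent S.nilradical ∧ Subsingleton (LieForms.EInf S.nilradical 0) := by
  -- Simplicity makes the Killing form nondegenerate and the root system irreducible; the dimension
  -- bound forces rank at least three.
  obtain ⟨hfin, hsimple, hrank⟩ := SplitLie.isSimple_of_isRealForm_classical h𝔤
  have hN := S.nilradical_toSubmodule
  refine ⟨LieAlgebra.IsKilling.isNilpotent_of_toSubmodule_eq hN,
    LieForms.subsingleton_EInf_zero fun ω hω z hz x => ?_⟩
  exact LieAlgebra.IsKilling.apply_eq_zero_of_mem_lowerCentralSeries
    (LieAlgebra.IsKilling.three_le_card_support S.base hrank) hN hω.1 hω.2 hz x
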